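/- Corollary 3.11 (uniquely hamiltonian multigraphs). Multigraphs are finite, may have parallel edges and have no loops. A hamiltonian cycle is regarded as a set of edges (so cycles using different parallel edges are different), and a multigraph is uniquely hamiltonian if it has exactly one hamiltonian cycle. The degree set of a multigraph $G$ with vertex set $V$ is $M_{deg}(G)=\{\deg(v) : v\in V\}$. Let $M$ be a finite set of natural numbers $d\ge 2$. There is a uniquely hamiltonian multigraph $G$ with $M_{deg}(G)=M$ if and only if $M$ contains an even number. In that case there are infinitely many pairwise non-isomorphic uniquely hamiltonian multigraphs $G$ with $M_{deg}(G)=M$ that are $3$-connected if $2\notin M$, and infinitely many that are $2$-connected if $2\in M$. -/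

import Mathlib

namespace Graph

/-- A multigraph: finitely many vertices and edges, parallel edges allowed, no loops. -/
structure IsMultigraph {α β : Type*} (G : Graph α β) : Prop where
  finite_vertexSet : G.vertexSet.Finite
  finite_edgeSet : G.edgeSet.Finite
  loopless : G.Loopless

/-- The degree of a vertex in a loopless multigraph: the number of edges incident with it,
parallel edges being counted separately. -/
noncomputable def degree {α β : Type*} (G : Graph α β) (x : α) : ℕ :=
  (G.incidenceSet x).ncard

/-- The set of the degrees of all vertices. -/
def degreeSet {α β : Type*} (G : Graph α β) : Set ℕ :=
  {d | ∃ x ∈ G.vertexSet, G.degree x = d}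

/-- `C` is the edge set of a hamiltonian cycle: the vertices of `G` can be arranged in a cyclic
order `v 0, …, v (n - 1)` without repetition such that `C` consists of `n` distinct edges `e i`,
where `e i` joins `v i` and `v (i + 1)` (indices modulo `n`). Cycles through different parallel
edges have different edge sets; two parallel edges form a cycle of length `2`. -/
def IsHamiltonianCycle {α β : Type*} (G : Graph α β) (C : Set β) : Prop :=
  ∃ n : ℕ, 2 ≤ n ∧ ∃ (v : ZMod n → α) (e : ZMod n → β),
    Function.Injective v ∧ Set.range v = G.vertexSet ∧
    Function.Injective e ∧ Set.range e = C ∧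
    ∀ i, G.IsLink (e i) (v i) (v (i + 1))

/-- There is exactly one hamiltonian cycle. -/
def IsUniquelyHamiltonian {α β : Type*} (G : Graph α β) : Prop :=
  ∃! C : Set β, G.IsHamiltonianCycle C

/-- There is a vertex, and any two vertices are joined by a path. -/
def IsConnected {α β : Type*} (G : Graph α β) : Prop :=
  G.vertexSet.Nonempty ∧
    ∀ x ∈ G.vertexSet, ∀ y ∈ G.vertexSet, Relation.ReflTransGen G.Adj x y

/-- `k`-connectedness: more than `k` vertices, and the deletion of fewer than `k` vertices
always leaves a connected graph. -/
def IsKConnected {α β : Type*} (G : Graph α β) (k : ℕ) : Prop :=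
  (k : ℕ∞) < G.vertexSet.encard ∧
    ∀ X : Finset α, X.card < k → (G.deleteVerts (X : Set α)).IsConnected

/-- Isomorphism of multigraphs: bijections of the vertices and of the edges which respect
incidence. -/
def IsIsomorphic {α β α' β' : Type*} (G : Graph α β) (H : Graph α' β') : Prop :=
  ∃ (f : G.vertexSet ≃ H.vertexSet) (g : G.edgeSet ≃ H.edgeSet),
    ∀ (e : G.edgeSet) (x y : G.vertexSet),
      G.IsLink (e : β) (x : α) (y : α) ↔ H.IsLink (g e : β') (f x : α') (f y : α')

end Graph

/-- `G` is a uniquely hamiltonian multigraph whose degree set is exactly `M`. -/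
def IsUHMultigraphWithDegrees {α β : Type*} (G : Graph α β) (M : Finset ℕ) : Prop :=
  G.IsMultigraph ∧ G.IsUniquelyHamiltonian ∧ G.degreeSet = (M : Set ℕ)

/-- There are infinitely many pairwise non-isomorphic `k`-connected uniquely hamiltonian
multigraphs with degree set `M`. (Every finite multigraph is isomorphic to one whose vertices
and edges are natural numbers.) -/
def InfinitelyManyKConnectedUH (k : ℕ) (M : Finset ℕ) : Prop :=
  ∃ G : ℕ → Graph ℕ ℕ,
    (∀ i, IsUHMultigraphWithDegrees (G i) M ∧ (G i).IsKConnected k) ∧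
    ∀ i j, i ≠ j → ¬ (G i).IsIsomorphic (G j)

/-! If all degrees are odd, Thomason's lollipop argument shows that every edge lies on an even
number of hamiltonian cycles, so there is never exactly one.

Conversely, replace a vertex with three neighbors by a triangle with one `k`-fold edge, opposite to
the corner which keeps the edge outside of the unique hamiltonian cycle. Every hamiltonian cycle
passes through the triangle once, so contraction of the triangle shows that the hamiltonian cycle
remains unique. Two vertices of degree `k + 2` have been added, no other degree has changed, and the
construction can be repeated at a corner. It starts from a `2 * r + 2`-regular multigraph with a
unique hamiltonian cycle: a cycle of length `28` with multiplied chords, none of which lies on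
a hamiltonian cycle. -/

open scoped Graph
open Function

section Parity

variable {α β : Type*} {G : Graph α β} {m : ℕ} {x : α} {a : β}

/-- A lollipop: a hamiltonian path that starts at `x` with the edge `a`, together with a further
edge from the last vertex of the path to an earlier one, the hook. The edges of the path come
first, the further edge is the last one. -/
@[ext]
structure Lollipop (G : Graph α β) (m : ℕ) (x : α) (a : β) where
  vertex : Fin (m + 2) → α
  edge : Fin (m + 2) → β
  hook : Fin (m + 1)
  vertex_injective : Injective vertex
  range_vertex : Set.range vertex = V(G)
  edge_injective : Injective edge
  vertex_zero : vertex 0 = x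
  edge_zero : edge 0 = a
  isLink_castSucc (i : Fin (m + 1)) :
    G.IsLink (edge i.castSucc) (vertex i.castSucc) (vertex i.succ)
  isLink_last : G.IsLink (edge (Fin.last _)) (vertex (Fin.last _)) (vertex hook.castSucc)

/-- The permutation of the indices `0, …, n - 1` that reverses the segment `j, …, n - 1`. -/
def reverseFrom (n j : ℕ) : Equiv.Perm (Fin n) :=
  Involutive.toPerm
    (fun i ↦ if h : j ≤ i then ⟨n - 1 + j - i, by omega⟩ else i)
    (fun i ↦ by ext; dsimp only; split_ifs <;> dsimp only at * <;> omega)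

lemma val_reverseFrom_of_le {n j : ℕ} {i : Fin n} (h : j ≤ i) :
    (reverseFrom n j i : ℕ) = n - 1 + j - i := by
  change ((if h : j ≤ i then _ else i : Fin n) : ℕ) = _
  rw [dif_pos h]

lemma reverseFrom_of_lt {n j : ℕ} {i : Fin n} (h : i < j) : reverseFrom n j i = i :=
  dif_neg (not_le.2 h)

lemma reverseFrom_reverseFrom {n : ℕ} (j : ℕ) (i : Fin n) :
    reverseFrom n j (reverseFrom n j i) = i :=
  Involutive.toPerm_involutive _ i

lemma reverseFrom_eq_of_add_eq {n j : ℕ} {i k : Fin n} (hi : j ≤ i) (h : (i + k : ℕ) = n - 1 + j) :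
    reverseFrom n j i = k := by
  ext; rw [val_reverseFrom_of_le hi]; omega

namespace Lollipop

/-- The lollipop exchange: the path is rerouted through the further edge and gives up the edge
that leaves the hook. A closed lollipop, one with hook `0`, is left alone. -/
def exchange (p : Lollipop G m x a) : Lollipop G m x a :=
  if h0 : p.hook = 0 then p else
  { vertex := p.vertex ∘ reverseFrom _ (p.hook + 1)
    edge := p.edge ∘ reverseFrom _ p.hook
    hook := p.hook
    vertex_injective := p.vertex_injective.comp (Equiv.injective _)
    range_vertex := by rw [EquivLike.range_comp, p.range_vertex]
    edge_injective := p.edge_injective.comp (Equiv.injective _)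
    vertex_zero := by rw [comp_apply, reverseFrom_of_lt (by simp), p.vertex_zero]
    edge_zero := by
      rw [comp_apply, reverseFrom_of_lt (by simpa [Fin.pos_iff_ne_zero] using h0), p.edge_zero]
    isLink_castSucc := fun i ↦ by
      simp only [comp_apply]
      rcases lt_trichotomy i p.hook with hi | rfl | hi
      · rw [reverseFrom_of_lt (i := i.castSucc) (by grind), reverseFrom_of_lt (by grind),
          reverseFrom_of_lt (by grind)]
        exact p.isLink_castSucc i
      · rw [reverseFrom_eq_of_add_eq (k := Fin.last _) (by grind) (by grind),
          reverseFrom_of_lt (by grind),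
          reverseFrom_eq_of_add_eq (k := Fin.last _) (by grind) (by grind)]
        exact p.isLink_last.symm
      · let k : Fin (m + 1) := ⟨m + 1 + p.hook - i, by omega⟩
        rw [reverseFrom_eq_of_add_eq (k := k.castSucc) (by grind) (by grind),
          reverseFrom_eq_of_add_eq (k := k.succ) (by grind) (by grind),
          reverseFrom_eq_of_add_eq (k := k.castSucc) (by grind) (by grind)]
        exact (p.isLink_castSucc k).symm
    isLink_last := by
      simp only [comp_apply]
      rw [reverseFrom_eq_of_add_eq (k := p.hook.castSucc) (by grind) (by grind),
        reverseFrom_eq_of_add_eq (k := p.hook.succ) (by grind) (by grind),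
        reverseFrom_of_lt (by grind)]
      exact (p.isLink_castSucc p.hook).symm }

lemma exchange_of_hook_eq_zero {p : Lollipop G m x a} (h : p.hook = 0) : p.exchange = p :=
  dif_pos h

lemma hook_exchange (p : Lollipop G m x a) : p.exchange.hook = p.hook := by
  unfold exchange; split_ifs <;> rfl

lemma vertex_exchange {p : Lollipop G m x a} (h : p.hook ≠ 0) :
    p.exchange.vertex = p.vertex ∘ reverseFrom _ (p.hook + 1) := by
  rw [exchange, dif_neg h]

lemma edge_exchange {p : Lollipop G m x a} (h : p.hook ≠ 0) :
    p.exchange.edge = p.edge ∘ reverseFrom _ p.hook := by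
  rw [exchange, dif_neg h]

lemma exchange_involutive : Involutive (exchange : Lollipop G m x a → Lollipop G m x a) := by
  intro p
  by_cases h : p.hook = 0
  · rw [exchange_of_hook_eq_zero h, exchange_of_hook_eq_zero h]
  have h' : p.exchange.hook ≠ 0 := by rwa [hook_exchange]
  ext i
  · simp [vertex_exchange h', vertex_exchange h, hook_exchange, reverseFrom_reverseFrom]
  · simp [edge_exchange h', edge_exchange h, hook_exchange, reverseFrom_reverseFrom]
  · rw [hook_exchange, hook_exchange]

lemma exchange_eq_self_iff {p : Lollipop G m x a} : p.exchange = p ↔ p.hook = 0 := by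
  refine ⟨fun h ↦ by_contra fun h0 ↦ ?_, exchange_of_hook_eq_zero⟩
  have hlast := congrFun (edge_exchange h0) (Fin.last _)
  rw [h, comp_apply, reverseFrom_eq_of_add_eq (k := p.hook.castSucc) (by grind) (by grind)] at hlast
  exact p.edge_injective.ne (Fin.castSucc_lt_last _).ne hlast.symm

lemma edge_mem (p : Lollipop G m x a) (i : Fin (m + 2)) : p.edge i ∈ E(G) :=
  Fin.lastCases p.isLink_last.edge_mem (fun i ↦ (p.isLink_castSucc i).edge_mem) i

lemma vertex_mem (p : Lollipop G m x a) (i : Fin (m + 2)) : p.vertex i ∈ V(G) :=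
  p.range_vertex ▸ Set.mem_range_self i

lemma hook_eq {p q : Lollipop G m x a} (hv : p.vertex = q.vertex)
    (he : p.edge (Fin.last _) = q.edge (Fin.last _)) : p.hook = q.hook := by
  have h := p.isLink_last
  rw [hv, he] at h
  exact Fin.castSucc_injective _ (q.vertex_injective (h.right_unique q.isLink_last))

lemma eq_of_path_eq {p q : Lollipop G m x a} (hv : p.vertex = q.vertex)
    (hinit : Fin.init p.edge = Fin.init q.edge)
    (hlast : p.edge (Fin.last _) = q.edge (Fin.last _)) : p = q := by
  refine Lollipop.ext hv ?_ (hook_eq hv hlast)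
  rw [← Fin.snoc_init_self p.edge, ← Fin.snoc_init_self q.edge, hinit, hlast]

lemma exists_edge_last_eq (hG : G.Loopless) (p : Lollipop G m x a) {f : β}
    (hf : G.Inc f (p.vertex (Fin.last _))) (hne : f ≠ p.edge (Fin.last m).castSucc) :
    ∃ q : Lollipop G m x a, q.vertex = p.vertex ∧ Fin.init q.edge = Fin.init p.edge ∧
      q.edge (Fin.last _) = f := by
  obtain ⟨y, hy⟩ := hf
  obtain ⟨j, rfl⟩ := p.range_vertex ▸ hy.right_mem
  induction j using Fin.lastCases with
  | last => exact (hG.not_isLoopAt _ _ hy).elim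
  | cast j =>
    have hnew : f ∉ Set.range (Fin.init p.edge) := by
      rintro ⟨i, rfl⟩
      obtain h | h := hy.left_eq_or_eq (p.isLink_castSucc i)
      · exact (Fin.castSucc_lt_last i).ne' (p.vertex_injective h)
      · exact hne (by rw [← Fin.succ_eq_last_succ.1 (p.vertex_injective h).symm]; rfl)
    have hinit : Injective (Fin.init p.edge) :=
      p.edge_injective.comp (Fin.castSucc_injective _)
    exact ⟨{ p with
      edge := Fin.snoc (α := fun _ ↦ β) (Fin.init p.edge) f
      hook := j
      edge_injective := Fin.snoc_injective_of_injective hinit hnew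
      edge_zero := by
        rw [← Fin.castSucc_zero, Fin.snoc_castSucc]
        exact p.edge_zero
      isLink_castSucc := fun i ↦ by
        rw [Fin.snoc_castSucc]
        exact p.isLink_castSucc i
      isLink_last := by rwa [Fin.snoc_last] },
      rfl, Fin.init_snoc (α := fun _ ↦ β) _ _, Fin.snoc_last (α := fun _ ↦ β) _ _⟩

lemma finite (hG : G.IsMultigraph) : Finite (Lollipop G m x a) := by
  have := hG.finite_vertexSet.to_subtype
  have := hG.finite_edgeSet.to_subtype
  refine Finite.of_injective (β := (Fin (m + 2) → V(G)) × (Fin (m + 2) → E(G)) × Fin (m + 1))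
    (fun p ↦ (fun i ↦ ⟨p.vertex i, p.vertex_mem i⟩, fun i ↦ ⟨p.edge i, p.edge_mem i⟩, p.hook))
    fun p q h ↦ ?_
  simp only [Prod.mk.injEq, funext_iff, Subtype.mk.injEq] at h
  exact Lollipop.ext (funext h.1) (funext h.2.1) h.2.2

/-- The last edge of a lollipop may be any edge at its last vertex but the last one of the path. -/
lemma ncard_same_path (hG : G.IsMultigraph) (p : Lollipop G m x a) :
    {q : Lollipop G m x a | q.vertex = p.vertex ∧ Fin.init q.edge = Fin.init p.edge}.ncard + 1 =
      G.degree (p.vertex (Fin.last _)) := by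
  have himage : (fun q : Lollipop G m x a ↦ q.edge (Fin.last _)) ''
      {q | q.vertex = p.vertex ∧ Fin.init q.edge = Fin.init p.edge} =
      G.incidenceSet (p.vertex (Fin.last _)) \ {p.edge (Fin.last m).castSucc} := by
    ext f
    constructor
    · rintro ⟨q, ⟨hv, he⟩, rfl⟩
      have : q.edge (Fin.last m).castSucc = p.edge (Fin.last m).castSucc :=
        congrFun he (Fin.last m)
      exact ⟨hv ▸ q.isLink_last.inc_left,
        this ▸ q.edge_injective.ne (Fin.castSucc_lt_last _).ne'⟩
    · rintro ⟨hf, hne⟩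
      obtain ⟨q, hv, he, hq⟩ := p.exists_edge_last_eq hG.loopless hf hne
      exact ⟨q, ⟨hv, he⟩, hq⟩
  rw [← Set.InjOn.ncard_image (f := fun q : Lollipop G m x a ↦ q.edge (Fin.last _)), himage]
  · exact Set.ncard_sdiff_singleton_add_one (p.isLink_castSucc (Fin.last m)).inc_right
      (hG.finite_edgeSet.subset (G.incidenceSet_subset_edgeSet _))
  · rintro q ⟨hv, he⟩ r ⟨hv', he'⟩ h
    exact eq_of_path_eq (hv.trans hv'.symm) (he.trans he'.symm) h

lemma even_card (hG : G.IsMultigraph) (hodd : ∀ y ∈ V(G), y ≠ x → Odd (G.degree y)) :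
    Even (Nat.card (Lollipop G m x a)) := by
  classical
  have := finite (m := m) (x := x) (a := a) hG
  have := Fintype.ofFinite (Lollipop G m x a)
  rw [Nat.card_eq_fintype_card, ← Finset.card_univ, Finset.card_eq_sum_card_image
    (fun p : Lollipop G m x a ↦ (p.vertex, Fin.init p.edge))]
  refine Finset.even_sum _ fun c hc ↦ ?_
  obtain ⟨p, -, rfl⟩ := Finset.mem_image.1 hc
  have hne : p.vertex (Fin.last _) ≠ x := fun h ↦
    Fin.last_pos.ne' (p.vertex_injective (h.trans p.vertex_zero.symm))
  have hlast := hodd _ (p.vertex_mem _) hne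
  rw [← p.ncard_same_path hG, Nat.odd_add_one, Nat.not_odd_iff_even] at hlast
  rw [← Set.ncard_coe_finset]
  simpa only [Finset.coe_filter_univ, Prod.mk.injEq] using hlast

/-- Thomason's lollipop argument: the closed lollipops are the fixed points of the exchange. -/
lemma even_card_hook_eq_zero (hG : G.IsMultigraph)
    (hodd : ∀ y ∈ V(G), y ≠ x → Odd (G.degree y)) :
    Even (Nat.card {p : Lollipop G m x a // p.hook = 0}) := by
  classical
  have := finite (m := m) (x := x) (a := a) hG
  have := Fintype.ofFinite (Lollipop G m x a)
  have hfixed := Equiv.Perm.card_fixedPoints_modEq (p := 2) (n := 1)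
    (f := (exchange : Lollipop G m x a → Lollipop G m x a)) (funext exchange_involutive)
  have heven := even_card (m := m) (x := x) (a := a) hG hodd
  rw [Nat.card_eq_fintype_card, Nat.even_iff, hfixed, ← Nat.even_iff] at heven
  convert heven
  rw [Nat.card_eq_fintype_card]
  exact Fintype.card_congr (Equiv.subtypeEquivRight fun p ↦ exchange_eq_self_iff.symm)

lemma eq_castSucc_or_eq_succ_of_inc {p : Lollipop G m x a} (h0 : p.hook = 0) {k : Fin (m + 2)}
    {i : Fin (m + 1)} (h : G.Inc (p.edge k) (p.vertex i.succ)) :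
    k = i.castSucc ∨ k = i.succ := by
  induction k using Fin.lastCases with
  | last =>
    obtain h | h := h.eq_or_eq_of_isLink p.isLink_last
    · exact .inr (p.vertex_injective h).symm
    · rw [h0] at h
      exact (Fin.succ_ne_zero i (p.vertex_injective h)).elim
  | cast k =>
    obtain h | h := h.eq_or_eq_of_isLink (p.isLink_castSucc k)
    · exact .inr (p.vertex_injective h).symm
    · exact .inl (congrArg _ (Fin.succ_injective _ (p.vertex_injective h)).symm)

/-- A hamiltonian cycle is determined by its edge set once a starting vertex and a first edge are
chosen. -/
lemma eq_of_range_edge_eq {p q : Lollipop G m x a} (hq : q.hook = 0)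
    (h : Set.range p.edge = Set.range q.edge) : p = q := by
  have heq (i : Fin (m + 2)) : p.vertex i = q.vertex i ∧ p.edge i = q.edge i := by
    induction i using Fin.induction with
    | zero => exact ⟨p.vertex_zero.trans q.vertex_zero.symm, p.edge_zero.trans q.edge_zero.symm⟩
    | succ i ih =>
      have hv : p.vertex i.succ = q.vertex i.succ := by
        have hlink := p.isLink_castSucc i
        rw [ih.1, ih.2] at hlink
        exact hlink.right_unique (q.isLink_castSucc i)
      obtain ⟨k, hk⟩ : p.edge i.succ ∈ Set.range q.edge := h ▸ Set.mem_range_self _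
      have hinc : G.Inc (q.edge k) (q.vertex i.succ) := by
        rw [hk, ← hv]
        exact Fin.lastCases (motive := fun j ↦ G.Inc (p.edge j) (p.vertex j))
          p.isLink_last.inc_left (fun j ↦ (p.isLink_castSucc j).inc_left) _
      obtain rfl | rfl := eq_castSucc_or_eq_succ_of_inc hq hinc
      · rw [← ih.2] at hk
        exact ((Fin.castSucc_lt_succ).ne (p.edge_injective hk)).elim
      · exact ⟨hv, hk.symm⟩
  have hvertex := funext fun i ↦ (heq i).1
  exact Lollipop.ext hvertex (funext fun i ↦ (heq i).2) (hook_eq hvertex (heq _).2)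

end Lollipop

lemma isHamiltonianCycle_iff_exists_fin {C : Set β} :
    G.IsHamiltonianCycle C ↔ ∃ (n : ℕ) (v : Fin (n + 2) → α) (e : Fin (n + 2) → β),
      Injective v ∧ Set.range v = V(G) ∧ Injective e ∧ Set.range e = C ∧
        ∀ i, G.IsLink (e i) (v i) (v (i + 1)) := by
  constructor
  · rintro ⟨n, hn, h⟩
    obtain ⟨n, rfl⟩ := Nat.exists_eq_add_of_le' hn
    exact ⟨n, h⟩
  · rintro ⟨n, h⟩
    exact ⟨n + 2, Nat.le_add_left 2 n, h⟩

lemma isHamiltonianCycle_iff_exists_lollipop {C : Set β} :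
    G.IsHamiltonianCycle C ↔
      ∃ m x a, ∃ p : Lollipop G m x a, p.hook = 0 ∧ Set.range p.edge = C := by
  rw [isHamiltonianCycle_iff_exists_fin]
  constructor
  · rintro ⟨m, v, e, hv, hrange, he, rfl, hlink⟩
    refine ⟨m, v 0, e 0, ⟨v, e, 0, hv, hrange, he, rfl, rfl, fun i ↦ ?_, ?_⟩, rfl, rfl⟩
    · rw [← Fin.coeSucc_eq_succ]
      exact hlink i.castSucc
    · rw [Fin.castSucc_zero, ← Fin.last_add_one]
      exact hlink (Fin.last _)
  · rintro ⟨m, x, a, p, h0, rfl⟩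
    refine ⟨m, p.vertex, p.edge, p.vertex_injective, p.range_vertex, p.edge_injective, rfl,
      fun i ↦ ?_⟩
    induction i using Fin.lastCases with
    | last =>
      rw [Fin.last_add_one, ← Fin.castSucc_zero, ← h0]
      exact p.isLink_last
    | cast i =>
      rw [Fin.coeSucc_eq_succ]
      exact p.isLink_castSucc i

theorem not_isUniquelyHamiltonian_of_odd_degree (hG : G.IsMultigraph)
    (hodd : ∀ y ∈ V(G), Odd (G.degree y)) : ¬ G.IsUniquelyHamiltonian := by
  rintro ⟨C, hC, hunique⟩
  obtain ⟨m, x, a, p, hp, rfl⟩ := isHamiltonianCycle_iff_exists_lollipop.1 hC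
  have heven := Lollipop.even_card_hook_eq_zero (m := m) (x := x) (a := a) hG
    fun y hy _ ↦ hodd y hy
  have : Unique {q : Lollipop G m x a // q.hook = 0} :=
    { default := ⟨p, hp⟩
      uniq := fun q ↦ Subtype.ext <| Lollipop.eq_of_range_edge_eq hp <|
        hunique _ <| isHamiltonianCycle_iff_exists_lollipop.2 ⟨m, x, a, q.1, q.2, rfl⟩ }
  simp at heven

end Parity

section SpanningCycle

variable {V W : Type*}

open SimpleGraph

/-- A spanning (hamiltonian) cycle, as a graph on all vertices: connected and `2`-regular. For
finite `V` these are the hamiltonian cycles of length at least `3`. -/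
structure IsSpanningCycle (C : SimpleGraph V) : Prop where
  connected : C.Connected
  ncard_neighborSet (x : V) : (C.neighborSet x).ncard = 2

lemma cycleGraph_adj_iff_eq_add_one {n : ℕ} {i j : Fin (n + 2)} :
    (cycleGraph (n + 2)).Adj i j ↔ i = j + 1 ∨ j = i + 1 := by
  rw [cycleGraph_adj, sub_eq_iff_eq_add, sub_eq_iff_eq_add, add_comm 1 j, add_comm 1 i]

lemma cycleGraph_adj_castSucc_succ {n : ℕ} (i : Fin (n + 1)) :
    (cycleGraph (n + 2)).Adj i.castSucc i.succ :=
  cycleGraph_adj_iff_eq_add_one.2 (.inr Fin.coeSucc_eq_succ.symm)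

lemma injective_mk_add_one (m : ℕ) : Injective fun i : Fin (m + 3) ↦ s(i, i + 1) := by
  intro i j h
  obtain ⟨h, -⟩ | ⟨h, h'⟩ := Sym2.eq_iff.1 h
  · exact h
  · rw [h, add_assoc, add_eq_left] at h'
    exact absurd h' (by
      simp [Fin.ext_iff, Fin.val_add, Nat.mod_eq_of_lt (show 2 < m + 3 by omega)])

lemma isSpanningCycle_cycleGraph (m : ℕ) : IsSpanningCycle (cycleGraph (m + 3)) where
  connected := cycleGraph_connected
  ncard_neighborSet x := by
    rw [← coe_neighborFinset, Set.ncard_coe_finset]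
    exact cycleGraph_degree_three_le

namespace IsSpanningCycle

variable {C D : SimpleGraph V} {E : SimpleGraph W}

lemma of_iso (hE : IsSpanningCycle E) (φ : E ≃g C) : IsSpanningCycle C where
  connected := φ.connected_iff.1 hE.connected
  ncard_neighborSet x := by
    rw [← φ.apply_symm_apply x, ← hE.ncard_neighborSet (φ.symm x)]
    exact (Nat.card_congr (φ.mapNeighborSet (φ.symm x))).symm

lemma finite_neighborSet (hC : IsSpanningCycle C) (x : V) : (C.neighborSet x).Finite :=
  Set.finite_of_ncard_ne_zero (by simp [hC.ncard_neighborSet])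

lemma eq_of_le (hC : IsSpanningCycle C) (hD : IsSpanningCycle D) (h : C ≤ D) : C = D := by
  ext x y
  have hx : C.neighborSet x = D.neighborSet x :=
    Set.eq_of_subset_of_ncard_le (fun z hz ↦ h hz)
      (by rw [hC.ncard_neighborSet, hD.ncard_neighborSet]) (hD.finite_neighborSet x)
  exact Set.ext_iff.1 hx y

lemma exists_equiv [Finite V] (hC : IsSpanningCycle C) (v : V) :
    ∃ m, ∃ s : Fin (m + 3) ≃ V, s 0 = v ∧ ∀ i, C.Adj (s i) (s (i + 1)) := by
  obtain ⟨p, hp, hverts⟩ := IsCycles.exists_cycle_toSubgraph_verts_eq_connectedComponentSupp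
    (G := C) (c := C.connectedComponentMk v) (v := v) (fun x _ ↦ hC.ncard_neighborSet x) rfl
    (Set.nonempty_of_ncard_ne_zero (by simp [hC.ncard_neighborSet]))
  obtain ⟨m, hm⟩ := Nat.exists_eq_add_of_le' hp.three_le_length
  let s (i : Fin (m + 3)) : V := p.getVert i
  have hinj : Injective s := fun i j hij ↦
    Fin.ext (hp.getVert_injOn' (by grind) (by grind) hij)
  have hsurj : Surjective s := fun x ↦ by
    have hx : x ∈ p.support := by
      rw [← p.mem_verts_toSubgraph, hverts]
      exact ConnectedComponent.sound (hC.connected x v)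
    obtain ⟨i, rfl, hi⟩ := Walk.mem_support_iff_exists_getVert.1 hx
    obtain rfl | hi := hi.eq_or_lt
    · exact ⟨0, by simp [s]⟩
    · exact ⟨⟨i, by omega⟩, rfl⟩
  refine ⟨m, Equiv.ofBijective s ⟨hinj, hsurj⟩, p.getVert_zero, fun i ↦ ?_⟩
  have hadj := p.adj_getVert_succ (i := i) (by omega)
  change C.Adj (s i) (s (i + 1))
  induction i using Fin.lastCases with
  | last => simpa [s, ← hm] using hadj
  | cast i => simpa [s] using hadj

lemma exists_iso [Finite V] (hC : IsSpanningCycle C) (v : V) :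
    ∃ m, ∃ φ : cycleGraph (m + 3) ≃g C, φ 0 = v := by
  obtain ⟨m, s, hs, hadj⟩ := hC.exists_equiv v
  have hle : cycleGraph (m + 3) ≤ C.comap s := fun i j hij ↦ by
    obtain rfl | rfl := cycleGraph_adj_iff_eq_add_one.1 hij
    · exact (hadj j).symm
    · exact hadj i
  have heq := (isSpanningCycle_cycleGraph m).eq_of_le (hC.of_iso (Iso.comap s C).symm) hle
  exact ⟨m, ⟨s, by rw [heq]; rfl⟩, hs⟩

lemma three_le_card [Finite V] (hC : IsSpanningCycle C) : 3 ≤ Nat.card V := by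
  obtain ⟨m, φ, -⟩ := hC.exists_iso hC.connected.nonempty.some
  rw [← Nat.card_congr φ.toEquiv, Nat.card_fin]
  omega

end IsSpanningCycle

end SpanningCycle

section EdgeMultiplicity

open SimpleGraph

/-- A multigraph with vertex set `V`, given by the numbers of edges between any two vertices. -/
structure EdgeMultiplicity (V : Type*) where
  toFun : V → V → ℕ
  symm' (x y : V) : toFun x y = toFun y x
  self' (x : V) : toFun x x = 0

namespace EdgeMultiplicity

variable {V α β : Type*}

instance : CoeFun (EdgeMultiplicity V) fun _ ↦ V → V → ℕ := ⟨toFun⟩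

lemma symm (w : EdgeMultiplicity V) (x y : V) : w x y = w y x := w.symm' x y

lemma self (w : EdgeMultiplicity V) (x : V) : w x x = 0 := w.self' x

/-- The simple graph obtained by identifying parallel edges. -/
def support (w : EdgeMultiplicity V) : SimpleGraph V where
  Adj x y := w x y ≠ 0
  symm := ⟨fun x y h ↦ w.symm x y ▸ h⟩
  loopless := ⟨fun x h ↦ h (w.self x)⟩

lemma support_adj {w : EdgeMultiplicity V} {x y : V} : w.support.Adj x y ↔ w x y ≠ 0 := Iff.rfl

/-- The number of edges at a vertex. -/
def degree [Fintype V] (w : EdgeMultiplicity V) (x : V) : ℕ := ∑ y, w x y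

/-- The realization of an edge multiplicity as a multigraph. The vertices are named by `f`, and
the `w x y` parallel edges between `x` and `y` are `g (s(x, y), i)` for `i < w x y`. -/
def toGraph (w : EdgeMultiplicity V) (f : V ↪ α) (g : Sym2 V × ℕ ↪ β) : Graph α β where
  vertexSet := Set.range f
  IsLink b p q := ∃ x y i, i < w x y ∧ g (s(x, y), i) = b ∧ f x = p ∧ f y = q
  isLink_symm := by
    refine fun _ _ ↦ ⟨?_⟩
    rintro _ _ ⟨x, y, i, hi, rfl, rfl, rfl⟩
    exact ⟨y, x, i, w.symm x y ▸ hi, by rw [Sym2.eq_swap], rfl, rfl⟩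
  eq_or_eq_of_isLink_of_isLink := by
    rintro _ _ _ _ _ ⟨x, y, i, -, rfl, rfl, rfl⟩ ⟨x', y', i', -, h, rfl, rfl⟩
    have := congrArg Prod.fst (g.injective h)
    grind
  left_mem_of_isLink := by
    rintro _ _ _ ⟨x, y, i, -, -, rfl, -⟩
    exact Set.mem_range_self x

/-- `C` is the only spanning cycle of `w`, and no edge of `C` has a parallel one. -/
structure IsUniqueSpanningCycle (w : EdgeMultiplicity V) (C : SimpleGraph V) : Prop where
  isSpanningCycle : IsSpanningCycle C
  apply_eq_one {x y : V} : C.Adj x y → w x y = 1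
  eq_of_le {D : SimpleGraph V} : D ≤ w.support → IsSpanningCycle D → D = C

lemma IsUniqueSpanningCycle.le_support {w : EdgeMultiplicity V} {C : SimpleGraph V}
    (hC : w.IsUniqueSpanningCycle C) : C ≤ w.support := fun _ _ h ↦ by
  simp [support_adj, hC.apply_eq_one h]

section toGraph

variable {w : EdgeMultiplicity V} {f : V ↪ α} {g : Sym2 V × ℕ ↪ β}

lemma isLink_toGraph {b : β} {x y : V} :
    (w.toGraph f g).IsLink b (f x) (f y) ↔ ∃ i < w x y, g (s(x, y), i) = b := by
  constructor
  · rintro ⟨x', y', i, hi, rfl, hx, hy⟩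
    rw [← f.injective hx, ← f.injective hy]
    exact ⟨i, hi, rfl⟩
  · rintro ⟨i, hi, rfl⟩
    exact ⟨x, y, i, hi, rfl, rfl, rfl⟩

lemma adj_toGraph {x y : V} : (w.toGraph f g).Adj (f x) (f y) ↔ w.support.Adj x y := by
  constructor
  · rintro ⟨b, hb⟩
    obtain ⟨i, hi, -⟩ := isLink_toGraph.1 hb
    exact Nat.ne_zero_of_lt hi
  · exact fun h ↦ ⟨_, isLink_toGraph.2 ⟨0, Nat.pos_of_ne_zero h, rfl⟩⟩

lemma isMultigraph_toGraph [Finite V] : (w.toGraph f g).IsMultigraph where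
  finite_vertexSet := Set.finite_range f
  finite_edgeSet := by
    refine (Set.finite_iUnion fun x ↦ Set.finite_iUnion fun y ↦
      (Set.finite_Iio (w x y)).image fun i ↦ g (s(x, y), i)).subset ?_
    rintro _ ⟨_, _, x, y, i, hi, rfl, -, -⟩
    exact Set.mem_iUnion₂.2 ⟨x, y, i, hi, rfl⟩
  loopless := ⟨by
    rintro b _ ⟨x, y, i, hi, rfl, rfl, h⟩
    rw [f.injective h, w.self] at hi
    exact absurd hi (Nat.not_lt_zero i)⟩

lemma range_edge_of_iso {C : SimpleGraph V} {m : ℕ} (φ : cycleGraph (m + 3) ≃g C) :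
    Set.range (fun i ↦ g (s(φ i, φ (i + 1)), 0)) = (fun e ↦ g (e, 0)) '' C.edgeSet := by
  ext b
  constructor
  · rintro ⟨i, rfl⟩
    exact ⟨_, φ.map_adj_iff.2 (cycleGraph_adj_iff_eq_add_one.2 (.inr rfl)), rfl⟩
  · rintro ⟨e, he, rfl⟩
    induction e with | h x y =>
    obtain ⟨i, rfl⟩ := φ.surjective x
    obtain ⟨j, rfl⟩ := φ.surjective y
    obtain rfl | rfl := cycleGraph_adj_iff_eq_add_one.1 (φ.map_adj_iff.1 he)
    · exact ⟨j, by rw [Sym2.eq_swap]⟩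
    · exact ⟨i, rfl⟩

lemma degree_toGraph [Fintype V] (x : V) : (w.toGraph f g).degree (f x) = w.degree x := by
  let e (p : Σ y, Fin (w x y)) : β := g (s(x, p.1), p.2)
  have he : Injective e := by
    rintro ⟨y, i⟩ ⟨z, j⟩ h
    obtain ⟨hyz, hij⟩ := Prod.mk.inj (g.injective h)
    obtain rfl : y = z := Sym2.congr_right.1 hyz
    exact congrArg _ (Fin.ext hij)
  have hrange : (w.toGraph f g).incidenceSet (f x) = Set.range e := by
    ext b
    constructor
    · rintro ⟨q, x', y, i, hi, rfl, hx, rfl⟩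
      obtain rfl := f.injective hx
      exact ⟨⟨y, i, hi⟩, rfl⟩
    · rintro ⟨⟨y, i, hi⟩, rfl⟩
      exact ⟨f y, isLink_toGraph.2 ⟨i, hi, rfl⟩⟩
  rw [Graph.degree, hrange, ← Nat.card_coe_set_eq, Nat.card_range_of_injective he]
  simp [degree]

lemma degreeSet_toGraph [Fintype V] : (w.toGraph f g).degreeSet = Set.range w.degree := by
  ext d
  constructor
  · rintro ⟨_, ⟨x, rfl⟩, rfl⟩
    exact ⟨x, (degree_toGraph x).symm⟩
  · rintro ⟨x, rfl⟩
    exact ⟨f x, ⟨x, rfl⟩, degree_toGraph x⟩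

lemma isHamiltonianCycle_toGraph [Finite V] {C : SimpleGraph V}
    (hC : w.IsUniqueSpanningCycle C) :
    (w.toGraph f g).IsHamiltonianCycle ((fun e ↦ g (e, 0)) '' C.edgeSet) := by
  obtain ⟨m, φ, -⟩ := hC.isSpanningCycle.exists_iso hC.isSpanningCycle.connected.nonempty.some
  have hadj (i : Fin (m + 3)) : C.Adj (φ i) (φ (i + 1)) :=
    φ.map_adj_iff.2 (cycleGraph_adj_iff_eq_add_one.2 (.inr rfl))
  refine isHamiltonianCycle_iff_exists_fin.2 ⟨m + 1, f ∘ φ, fun i ↦ g (s(φ i, φ (i + 1)), 0),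
    f.injective.comp φ.injective, EquivLike.range_comp f φ, fun i j hij ↦ ?_,
    range_edge_of_iso φ, fun i ↦ isLink_toGraph.2 ⟨0, by simp [hC.apply_eq_one (hadj i)], rfl⟩⟩
  have hsym := congrArg Prod.fst (g.injective hij)
  refine injective_mk_add_one m (Sym2.map.injective φ.injective ?_)
  simpa using hsym

/-- The hamiltonian cycles of the realization are the spanning cycles, with a choice of one of the
parallel edges for each edge of the cycle. -/
theorem isUniquelyHamiltonian_toGraph [Finite V] {C : SimpleGraph V}
    (hC : w.IsUniqueSpanningCycle C) :
    (w.toGraph f g).IsUniquelyHamiltonian := by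
  refine ⟨_, isHamiltonianCycle_toGraph hC, fun B hB ↦ ?_⟩
  obtain ⟨n, v, e, hv, hrange, -, rfl, hlink⟩ := isHamiltonianCycle_iff_exists_fin.1 hB
  have hmem (i) : v i ∈ Set.range f := hrange.subset (Set.mem_range_self i)
  choose s hs using hmem
  have hinj : Injective s := fun i j h ↦ hv (by rw [← hs, h, hs])
  have hsurj : Surjective s := fun x ↦ by
    obtain ⟨i, hi⟩ : f x ∈ Set.range v := hrange.superset (Set.mem_range_self x)
    exact ⟨i, f.injective (by rw [hs, hi])⟩
  let t := Equiv.ofBijective s ⟨hinj, hsurj⟩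
  obtain ⟨m, rfl⟩ : ∃ m, n = m + 1 := Nat.exists_eq_add_of_le' <| by
    have := hC.isSpanningCycle.three_le_card
    rw [← Nat.card_congr t, Nat.card_fin] at this
    omega
  have hlink' (i) : ∃ k < w (s i) (s (i + 1)), g (s(s i, s (i + 1)), k) = e i :=
    isLink_toGraph.1 (by rw [hs, hs]; exact hlink i)
  have hle : (cycleGraph (m + 3)).map t ≤ w.support := by
    rintro _ _ ⟨-, i, j, hij, rfl, rfl⟩
    obtain rfl | rfl := cycleGraph_adj_iff_eq_add_one.1 hij
    · obtain ⟨k, hk, -⟩ := hlink' j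
      exact SimpleGraph.Adj.symm (Nat.ne_zero_of_lt hk : w.support.Adj (s j) (s (j + 1)))
    · obtain ⟨k, hk, -⟩ := hlink' i
      exact Nat.ne_zero_of_lt hk
  let φ := Iso.map t (cycleGraph (m + 3))
  have hmap := hC.eq_of_le hle ((isSpanningCycle_cycleGraph m).of_iso φ)
  rw [← hmap] at hC ⊢
  rw [← range_edge_of_iso φ]
  congr! 2 with i
  obtain ⟨k, hk, hki⟩ := hlink' i
  have hone : w (s i) (s (i + 1)) = 1 :=
    hC.apply_eq_one (φ.map_adj_iff.2 (cycleGraph_adj_iff_eq_add_one.2 (.inr rfl)))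
  rw [hone, Nat.lt_one_iff] at hk
  rw [← hki, hk]
  rfl

end toGraph

end EdgeMultiplicity

end EdgeMultiplicity

section Connectivity

open SimpleGraph

variable {V : Type*}

/-- Deletion of the vertices in `X`, on the same vertex type: they become isolated. -/
def isolate (G : SimpleGraph V) (X : Set V) : SimpleGraph V where
  Adj x y := G.Adj x y ∧ x ∉ X ∧ y ∉ X
  symm := ⟨fun _ _ h ↦ ⟨h.1.symm, h.2.2, h.2.1⟩⟩
  loopless := ⟨fun _ h ↦ h.1.ne rfl⟩

/-- `k`-connectedness: more than `k` vertices, and the deletion of fewer than `k` of them always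
leaves a connected graph. -/
structure IsVertexConnected (G : SimpleGraph V) (k : ℕ) : Prop where
  lt_card : k < Nat.card V
  reachable (X : Finset V) : X.card < k → ∀ x ∉ X, ∀ y ∉ X, (isolate G X).Reachable x y

lemma reachable_of_le_of_forall_adj {G : SimpleGraph V} {n : ℕ} {s : Fin (n + 1) → V}
    {i j : Fin (n + 1)} (hij : i ≤ j)
    (h : ∀ k : Fin n, i ≤ k.castSucc → k.succ ≤ j → G.Adj (s k.castSucc) (s k.succ)) :
    G.Reachable (s i) (s j) := by
  induction j using Fin.induction with
  | zero => rw [Fin.le_zero_iff.1 hij]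
  | succ j ih =>
    obtain rfl | hij := hij.eq_or_lt
    · rfl
    · have hij := Fin.le_castSucc_iff.2 hij
      exact (ih hij fun k hik hkj ↦ h k hik (hkj.trans (Fin.castSucc_le_succ j))).trans
        (h j hij le_rfl).reachable

lemma reachable_of_forall_adj_reachable {W : Type*} {G : SimpleGraph V} {H : SimpleGraph W}
    {f : V → W} (hf : ∀ x y, G.Adj x y → H.Reachable (f x) (f y)) {x y : V}
    (h : G.Reachable x y) : H.Reachable (f x) (f y) := by
  simp only [reachable_iff_reflTransGen] at *
  exact Relation.ReflTransGen.lift' f hf x y h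

lemma IsVertexConnected.isKConnected_toGraph {α β : Type*} {w : EdgeMultiplicity V} {k : ℕ}
    (hw : IsVertexConnected w.support k) (f : V ↪ α) (g : Sym2 V × ℕ ↪ β) :
    (w.toGraph f g).IsKConnected k := by
  classical
  have : Finite V := Nat.finite_of_card_ne_zero hw.lt_card.ne_bot
  have hcard : (k : ℕ∞) < (Set.range f).encard := by
    rw [← Set.image_univ, f.injective.encard_image, Set.encard_univ,
      ENat.card_eq_coe_natCard, Nat.cast_lt]
    exact hw.lt_card
  refine ⟨hcard, fun X hX ↦ ⟨?_, ?_⟩⟩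
  · refine Set.sdiff_nonempty.2 fun hsub ↦ hcard.not_ge ((Set.encard_le_encard hsub).trans ?_)
    rw [Set.encard_coe_eq_coe_finsetCard]
    exact_mod_cast hX.le
  · rintro _ ⟨⟨x, rfl⟩, hx⟩ _ ⟨⟨y, rfl⟩, hy⟩
    let Y : Finset V := X.preimage f f.injective.injOn
    have hY : Y.card < k := by
      rw [Finset.card_preimage]
      exact (Finset.card_filter_le _ _).trans_lt hX
    have hxy := hw.reachable Y hY x (by simpa [Y] using hx) y (by simpa [Y] using hy)
    rw [reachable_iff_reflTransGen] at hxy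
    refine hxy.lift f fun a b ⟨hab, ha, hb⟩ ↦ ?_
    obtain ⟨e, he⟩ := EdgeMultiplicity.adj_toGraph (f := f) (g := g).2 hab
    exact ⟨e, by simp_all [Y]⟩

namespace IsSpanningCycle

variable {C G : SimpleGraph V}

lemma reachable_isolate_singleton [Finite V] (hC : IsSpanningCycle C) (hle : C ≤ G) {p x y : V}
    (hx : x ≠ p) (hy : y ≠ p) : (isolate G {p}).Reachable x y := by
  obtain ⟨m, φ, rfl⟩ := hC.exists_iso p
  have hpath (i j : Fin (m + 3)) (hi : i ≠ 0) (hij : i ≤ j) :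
      (isolate G {φ 0}).Reachable (φ i) (φ j) := by
    refine reachable_of_le_of_forall_adj hij fun k hik _ ↦
      ⟨hle (φ.map_adj_iff.2 (cycleGraph_adj_castSucc_succ k)), ?_, ?_⟩
    · exact φ.injective.ne ((Fin.pos_iff_ne_zero.2 hi).trans_le hik).ne'
    · exact φ.injective.ne (Fin.succ_ne_zero k)
  obtain ⟨i, rfl⟩ := φ.surjective x
  obtain ⟨j, rfl⟩ := φ.surjective y
  have hi : i ≠ 0 := fun h ↦ hx (h ▸ rfl)
  have hj : j ≠ 0 := fun h ↦ hy (h ▸ rfl)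
  obtain hij | hij := le_total i j
  · exact hpath i j hi hij
  · exact (hpath j i hj hij).symm

lemma isVertexConnected_two [Finite V] (hC : IsSpanningCycle C) (hle : C ≤ G) :
    IsVertexConnected G 2 where
  lt_card := hC.three_le_card
  reachable X hX x hx y hy := by
    obtain rfl | ⟨p, rfl⟩ : X = ∅ ∨ ∃ p, X = {p} := by
      rw [← Finset.card_eq_zero, ← Finset.card_eq_one]
      omega
    · exact (hC.connected x y).mono fun a b h ↦ ⟨hle h, by simp, by simp⟩
    · rw [Finset.coe_singleton]
      exact hC.reachable_isolate_singleton hle (by simpa using hx) (by simpa using hy)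

end IsSpanningCycle

section Chords

variable {m : ℕ} {G : SimpleGraph (Fin (m + 2))} {p q i j : Fin (m + 2)}

lemma reachable_isolate_of_le (hle : cycleGraph (m + 2) ≤ G) {X : Set (Fin (m + 2))} (hij : i ≤ j)
    (h : ∀ k, i ≤ k → k ≤ j → k ∉ X) : (isolate G X).Reachable i j :=
  reachable_of_le_of_forall_adj (s := id) hij fun k hik hkj ↦
    ⟨hle (cycleGraph_adj_castSucc_succ k), h _ hik ((Fin.castSucc_le_succ k).trans hkj),
      h _ (hik.trans (Fin.castSucc_le_succ k)) hkj⟩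

lemma reachable_isolate_inside (hle : cycleGraph (m + 2) ≤ G) (hi : p < i ∧ i < q)
    (hj : p < j ∧ j < q) : (isolate G {p, q}).Reachable i j := by
  obtain hij | hij := le_total i j
  · exact reachable_isolate_of_le hle hij (by grind)
  · exact (reachable_isolate_of_le hle hij (by grind)).symm

lemma reachable_isolate_outside (hle : cycleGraph (m + 2) ≤ G) (hpq : p < q) (hi : i < p ∨ q < i)
    (hj : j < p ∨ q < j) : (isolate G {p, q}).Reachable i j := by
  wlog hij : i ≤ j generalizing i j
  · exact (this hj hi (le_of_not_ge hij)).symm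
  by_cases hwrap : i < p ∧ q < j
  · have hzero : (isolate G {p, q}).Reachable 0 i :=
      reachable_isolate_of_le hle (Fin.zero_le i) (by grind)
    have hlast : (isolate G {p, q}).Reachable j (Fin.last _) :=
      reachable_isolate_of_le hle (Fin.le_last j) (by grind)
    have hadj : (isolate G {p, q}).Adj 0 (Fin.last _) :=
      ⟨hle (cycleGraph_adj_iff_eq_add_one.2 (.inl (Fin.last_add_one _).symm)), by grind, by grind⟩
    exact (hzero.symm.trans hadj.reachable).trans hlast.symm
  · exact reachable_isolate_of_le hle hij (by grind)

/-- Two deleted vertices cut a hamiltonian cycle into two paths, which a chord reconnects. -/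
lemma reachable_isolate_pair (hle : cycleGraph (m + 2) ≤ G) (hpq : p < q)
    (hchord : (∃ i, p < i ∧ i < q) → (∃ i, i < p ∨ q < i) →
      ∃ i j, (p < i ∧ i < q) ∧ (j < p ∨ q < j) ∧ G.Adj i j)
    (hi : i ∉ ({p, q} : Set _)) (hj : j ∉ ({p, q} : Set _)) :
    (isolate G {p, q}).Reachable i j := by
  have hsplit {k} (hk : k ∉ ({p, q} : Set (Fin (m + 2)))) :
      (p < k ∧ k < q) ∨ (k < p ∨ q < k) := by grind
  obtain hi' | hi' := hsplit hi <;> obtain hj' | hj' := hsplit hj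
  · exact reachable_isolate_inside hle hi' hj'
  · obtain ⟨k, l, hk, hl, hkl⟩ := hchord ⟨i, hi'⟩ ⟨j, hj'⟩
    have hadj : (isolate G {p, q}).Adj k l := ⟨hkl, by grind, by grind⟩
    exact ((reachable_isolate_inside hle hi' hk).trans hadj.reachable).trans
      (reachable_isolate_outside hle hpq hl hj')
  · obtain ⟨k, l, hk, hl, hkl⟩ := hchord ⟨j, hj'⟩ ⟨i, hi'⟩
    have hadj : (isolate G {p, q}).Adj l k := ⟨hkl.symm, by grind, by grind⟩
    exact ((reachable_isolate_outside hle hpq hi' hl).trans hadj.reachable).trans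
      (reachable_isolate_inside hle hk hj')
  · exact reachable_isolate_outside hle hpq hi' hj'

end Chords

lemma isVertexConnected_three_of_chords {m : ℕ} {G : SimpleGraph (Fin (m + 4))}
    (hle : cycleGraph (m + 4) ≤ G)
    (hchord : ∀ p q : Fin (m + 4), p < q → (∃ i, p < i ∧ i < q) → (∃ i, i < p ∨ q < i) →
      ∃ i j, (p < i ∧ i < q) ∧ (j < p ∨ q < j) ∧ G.Adj i j) : IsVertexConnected G 3 where
  lt_card := by simp
  reachable X hX x hx y hy := by
    obtain hlt | heq := (Nat.lt_succ_iff.1 hX).lt_or_eq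
    · exact ((isSpanningCycle_cycleGraph (m + 1)).isVertexConnected_two hle).reachable X hlt
        x hx y hy
    obtain ⟨p, q, hne, rfl⟩ := Finset.card_eq_two.1 heq
    clear hX heq
    wlog hpq : p < q generalizing p q
    · rw [Finset.pair_comm] at *
      exact this q p hne.symm hx hy (hne.lt_or_gt.resolve_left hpq)
    rw [← Finset.mem_coe, Finset.coe_pair] at hx hy
    rw [Finset.coe_pair]
    exact reachable_isolate_pair hle hpq (hchord p q hpq) hx hy

end Connectivity

section Expansion

open SimpleGraph

lemma ncard_eq_two_iff_of_subset {α : Type*} {s : Set α} {a b c : α} (hab : a ≠ b) (hac : a ≠ c)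
    (hbc : b ≠ c) (hs : s ⊆ {a, b, c}) : s.ncard = 2 ↔
      (a ∈ s ∧ b ∈ s ∧ c ∉ s) ∨ (a ∈ s ∧ b ∉ s ∧ c ∈ s) ∨ (a ∉ s ∧ b ∈ s ∧ c ∈ s) := by
  constructor
  · rw [Set.ncard_eq_two]
    rintro ⟨x, y, hxy, rfl⟩
    have hx := hs (Set.mem_insert x {y})
    have hy := hs (Set.mem_insert_of_mem x rfl)
    grind
  · have hpair {x y z : α} (hxy : x ≠ y) (hs : s ⊆ {x, y, z}) (hx : x ∈ s) (hy : y ∈ s)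
        (hz : z ∉ s) : s.ncard = 2 := by
      rw [show s = {x, y} by grind, Set.ncard_pair hxy]
    rintro (⟨ha, hb, hc⟩ | ⟨ha, hb, hc⟩ | ⟨ha, hb, hc⟩)
    · exact hpair hab hs ha hb hc
    · exact hpair hac (by grind) ha hc hb
    · exact hpair hbc (by grind) hb hc ha

variable {V : Type*} {w : EdgeMultiplicity V} {C : SimpleGraph V} {k : ℕ}

/-- A vertex `center` whose neighbors on the cycle `C` are `side false` and `side true`, and which
in the multigraph `w` has at most one other neighbor, `third`. -/
structure CubicVertex (w : EdgeMultiplicity V) (C : SimpleGraph V) where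
  center : V
  side : Bool → V
  third : V
  side_injective : Injective side
  third_ne_side (i : Bool) : third ≠ side i
  adj_center_iff {x : V} : C.Adj center x ↔ ∃ i, x = side i
  eq_of_apply_ne_zero {x : V} : w center x ≠ 0 → x = third ∨ ∃ i, x = side i

namespace CubicVertex

variable {r : CubicVertex w C} {D : SimpleGraph (V ⊕ Bool)}

lemma adj_side (r : CubicVertex w C) (i : Bool) : C.Adj r.center (r.side i) :=
  r.adj_center_iff.2 ⟨i, rfl⟩

lemma side_ne_center (r : CubicVertex w C) (i : Bool) : r.side i ≠ r.center := (r.adj_side i).ne'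

open Classical in
/-- Replacement of the cubic vertex by a triangle: `inl center` keeps the third neighbor,
`inr i` takes over the neighbor `side i`, and these two new vertices are joined by `k` edges. -/
noncomputable def expand (r : CubicVertex w C) (k : ℕ) : EdgeMultiplicity (V ⊕ Bool) where
  toFun
    | .inl x, .inl y => if (x = r.center ∨ y = r.center) ∧ C.Adj x y then 0 else w x y
    | .inl x, .inr i => if x = r.center ∨ x = r.side i then 1 else 0
    | .inr i, .inl x => if x = r.center ∨ x = r.side i then 1 else 0
    | .inr i, .inr j => if i = j then 0 else k
  symm' := by
    rintro (x | i) (y | j)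
    · simp only [w.symm x y, C.adj_comm x y, or_comm]
    · rfl
    · rfl
    · simp only [eq_comm]
  self' := by
    rintro (x | i)
    · simp [w.self]
    · simp

/-- The cycle `C` with its path through the cubic vertex rerouted through the triangle. -/
def expandCycle (r : CubicVertex w C) : SimpleGraph (V ⊕ Bool) where
  Adj
    | .inl x, .inl y => C.Adj x y ∧ x ≠ r.center ∧ y ≠ r.center
    | .inl x, .inr i => x = r.center ∨ x = r.side i
    | .inr i, .inl x => x = r.center ∨ x = r.side i
    | .inr _, .inr _ => False
  symm := ⟨by rintro (x | i) (y | j) h <;> simp_all [C.adj_comm]⟩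
  loopless := ⟨by rintro (x | i) h <;> simp_all⟩

/-- The contraction of the triangle. -/
def contract (r : CubicVertex w C) : V ⊕ Bool → V := Sum.elim id fun _ ↦ r.center

section Adjacency

variable {x y : V} {i j : Bool}

lemma expand_support_adj_inl_inl : (r.expand k).support.Adj (.inl x) (.inl y) ↔
    w x y ≠ 0 ∧ ¬((x = r.center ∨ y = r.center) ∧ C.Adj x y) := by
  simp only [EdgeMultiplicity.support_adj, expand]
  split_ifs <;> simp_all

lemma expand_support_adj_inl_inr :
    (r.expand k).support.Adj (.inl x) (.inr i) ↔ x = r.center ∨ x = r.side i := by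
  simp [EdgeMultiplicity.support_adj, expand, or_iff_not_imp_left]

lemma expand_support_adj_inr_inr :
    (r.expand k).support.Adj (.inr i) (.inr j) ↔ i ≠ j ∧ k ≠ 0 := by
  simp [EdgeMultiplicity.support_adj, expand]

lemma expandCycle_adj_inl_inl : r.expandCycle.Adj (.inl x) (.inl y) ↔
    C.Adj x y ∧ x ≠ r.center ∧ y ≠ r.center := Iff.rfl

lemma expandCycle_adj_inl_inr :
    r.expandCycle.Adj (.inl x) (.inr i) ↔ x = r.center ∨ x = r.side i := Iff.rfl

end Adjacency

lemma apply_expandCycle_eq_one (hw : ∀ {x y}, C.Adj x y → w x y = 1) {p q : V ⊕ Bool}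
    (h : r.expandCycle.Adj p q) : r.expand k p q = 1 := by
  rcases p with x | i <;> rcases q with y | j
  · obtain ⟨h, hx, hy⟩ := h
    simp [expand, hx, hy, hw h]
  · exact if_pos h
  · exact if_pos h
  · exact h.elim

section Contraction

lemma eq_inl_of_contract_ne_center {p : V ⊕ Bool} (h : r.contract p ≠ r.center) :
    p = .inl (r.contract p) := by
  rcases p with x | i
  · rfl
  · exact absurd rfl h

lemma neighborSet_map_contract (D : SimpleGraph (V ⊕ Bool)) {x : V} (hx : x ≠ r.center) :
    (D.map r.contract).neighborSet x = r.contract '' D.neighborSet (.inl x) := by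
  ext y
  constructor
  · rintro ⟨-, p, q, hpq, rfl, rfl⟩
    exact ⟨q, eq_inl_of_contract_ne_center hx ▸ hpq, rfl⟩
  · rintro ⟨q, hq, rfl⟩
    refine ⟨fun h ↦ hq.ne ?_, _, _, hq, rfl, rfl⟩
    rw [eq_inl_of_contract_ne_center (p := q) (h ▸ hx), ← h]

lemma injOn_contract (hD : D ≤ (r.expand k).support) {x : V} (hx : x ≠ r.center) :
    Set.InjOn r.contract (D.neighborSet (.inl x)) := by
  have hside {i} (h : D.Adj (.inl x) (.inr i)) : x = r.side i :=
    (expand_support_adj_inl_inr.1 (hD h)).resolve_left hx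
  have hcenter {i} (h : D.Adj (.inl x) (.inl r.center)) : x ≠ r.side i := fun hi ↦
    (expand_support_adj_inl_inl.1 (hD h)).2 ⟨.inr rfl, hi ▸ (r.adj_side i).symm⟩
  rintro (y | i) hy (z | j) hz h
  · exact congrArg _ h
  · exact absurd (hside hz) (hcenter ((show y = r.center from h) ▸ hy))
  · exact absurd (hside hy) (hcenter ((show r.center = z from h) ▸ hz))
  · rw [r.side_injective ((hside hy).symm.trans (hside hz))]

lemma ncard_neighborSet_map_contract (hD : D ≤ (r.expand k).support) {x : V}
    (hx : x ≠ r.center) :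
    ((D.map r.contract).neighborSet x).ncard = (D.neighborSet (.inl x)).ncard := by
  rw [neighborSet_map_contract D hx, (injOn_contract hD hx).ncard_image]

lemma connected_map_contract (hD : D.Connected) : (D.map r.contract).Connected := by
  have := hD.nonempty.map r.contract
  refine ⟨fun x y ↦ reachable_of_forall_adj_reachable (f := r.contract) (fun p q hpq ↦ ?_)
    (hD (.inl x) (.inl y))⟩
  by_cases h : r.contract p = r.contract q
  · rw [h]
  · exact Adj.reachable ⟨h, p, q, hpq, rfl, rfl⟩

end Contraction

section SpanningCycle

lemma neighborSet_inl_center_subset (hD : D ≤ (r.expand k).support) :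
    D.neighborSet (.inl r.center) ⊆ {.inr false, .inr true, .inl r.third} := by
  rintro (x | i) h
  · have hx := expand_support_adj_inl_inl.1 (hD h)
    have hside : ¬ ∃ i, x = r.side i := fun hi ↦ hx.2 ⟨.inl rfl, r.adj_center_iff.2 hi⟩
    simp [(r.eq_of_apply_ne_zero hx.1).resolve_right hside]
  · cases i <;> simp

lemma neighborSet_inr_subset (hD : D ≤ (r.expand k).support) (i : Bool) :
    D.neighborSet (.inr i) ⊆ {.inl r.center, .inr !i, .inl (r.side i)} := by
  rintro (x | j) h
  · obtain rfl | rfl := expand_support_adj_inl_inr.1 (hD h).symm <;> simp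
  · have hij := (expand_support_adj_inr_inr.1 (hD h)).1
    simp [Bool.eq_not.2 hij.symm]

lemma adj_map_contract_center_iff (hD : D ≤ (r.expand k).support) {x : V} :
    (D.map r.contract).Adj r.center x ↔
      (x = r.third ∧ D.Adj (.inl r.center) (.inl r.third)) ∨
        ∃ i, x = r.side i ∧ D.Adj (.inr i) (.inl (r.side i)) := by
  constructor
  · rintro ⟨hne, p, q, hpq, hp, rfl⟩
    have hq := eq_inl_of_contract_ne_center (p := q) fun h ↦ hne h.symm
    rcases p with y | i
    · obtain rfl : y = r.center := hp
      have := neighborSet_inl_center_subset hD hpq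
      grind
    · have := neighborSet_inr_subset hD i hpq
      grind [r.side_ne_center i]
  · rintro (⟨rfl, h⟩ | ⟨i, rfl, h⟩)
    · exact ⟨fun hne ↦ h.ne (congrArg _ hne), _, _, h, rfl, rfl⟩
    · exact ⟨(r.side_ne_center i).symm, _, _, h, rfl, rfl⟩

lemma adj_map_contract_center_third_iff (hD : D ≤ (r.expand k).support) :
    (D.map r.contract).Adj r.center r.third ↔ D.Adj (.inl r.center) (.inl r.third) := by
  simp [adj_map_contract_center_iff hD, r.third_ne_side]

lemma adj_map_contract_center_side_iff (hD : D ≤ (r.expand k).support) {i : Bool} :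
    (D.map r.contract).Adj r.center (r.side i) ↔ D.Adj (.inr i) (.inl (r.side i)) := by
  simp [adj_map_contract_center_iff hD, (r.third_ne_side i).symm, r.side_injective.eq_iff]

/-- A spanning cycle takes two edges at each corner of the triangle, so it leaves the triangle
through an even number of the three outer edges; by connectedness, through two of them. -/
lemma ncard_neighborSet_map_contract_center (hD : D ≤ (r.expand k).support)
    (hcycle : IsSpanningCycle D) : ((D.map r.contract).neighborSet r.center).ncard = 2 := by
  have hsub : (D.map r.contract).neighborSet r.center ⊆ {r.third, r.side false, r.side true} := by
    intro x hx
    obtain ⟨rfl, -⟩ | ⟨_ | _, rfl, -⟩ := (adj_map_contract_center_iff hD).1 hx <;> simp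
  have : Nontrivial V := ⟨_, _, r.side_ne_center false⟩
  obtain ⟨x, hx⟩ := (connected_map_contract (r := r)
    hcycle.connected).preconnected.exists_adj_of_nontrivial r.center
  have hx := hsub hx
  have htwo := hcycle.ncard_neighborSet
  have hcenter := (ncard_eq_two_iff_of_subset (by simp) (by simp) (by simp)
    (neighborSet_inl_center_subset hD)).1 (htwo _)
  have hinr (i) := (ncard_eq_two_iff_of_subset (by simp) (by simp [(r.side_ne_center i).symm])
    (by simp) (neighborSet_inr_subset hD i)).1 (htwo _)
  have hfalse := hinr false
  have htrue := hinr true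
  rw [ncard_eq_two_iff_of_subset (r.third_ne_side _) (r.third_ne_side _)
    (r.side_injective.ne (by simp)) hsub]
  have hthird := adj_map_contract_center_third_iff hD
  have hside_false := adj_map_contract_center_side_iff hD (i := false)
  have hside_true := adj_map_contract_center_side_iff hD (i := true)
  simp only [mem_neighborSet, Bool.not_false, Bool.not_true, D.adj_comm (.inr _) (.inl r.center),
    D.adj_comm (.inr true) (.inr false)] at *
  grind

lemma isSpanningCycle_map_contract (hD : D ≤ (r.expand k).support) (hcycle : IsSpanningCycle D) :
    IsSpanningCycle (D.map r.contract) where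
  connected := connected_map_contract hcycle.connected
  ncard_neighborSet x := by
    by_cases hx : x = r.center
    · rw [hx, ncard_neighborSet_map_contract_center hD hcycle]
    · rw [ncard_neighborSet_map_contract hD hx, hcycle.ncard_neighborSet]

lemma map_contract_le_support (hC : C ≤ w.support) (hD : D ≤ (r.expand k).support) :
    D.map r.contract ≤ w.support := by
  rintro _ _ ⟨hne, x | i, y | j, h, rfl, rfl⟩
  · exact (expand_support_adj_inl_inl.1 (hD h)).1
  · obtain rfl | rfl := expand_support_adj_inl_inr.1 (hD h)
    · exact absurd rfl hne
    · exact hC (r.adj_side j).symm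
  · obtain rfl | rfl := expand_support_adj_inl_inr.1 (hD h).symm
    · exact absurd rfl hne
    · exact hC (r.adj_side i)
  · exact absurd rfl hne

lemma map_contract_expandCycle : r.expandCycle.map r.contract = C := by
  ext x y
  constructor
  · rintro ⟨hne, x | i, y | j, h, rfl, rfl⟩
    · exact h.1
    · exact (h.resolve_left hne) ▸ (r.adj_side j).symm
    · exact (h.resolve_left hne.symm) ▸ r.adj_side i
    · exact h.elim
  · intro h
    refine ⟨h.ne, ?_⟩
    by_cases hx : x = r.center
    · obtain ⟨i, rfl⟩ := r.adj_center_iff.1 (hx ▸ h)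
      exact ⟨.inr i, .inl (r.side i), .inr rfl, hx.symm, rfl⟩
    by_cases hy : y = r.center
    · obtain ⟨i, rfl⟩ := r.adj_center_iff.1 (hy ▸ h.symm)
      exact ⟨.inl (r.side i), .inr i, .inr rfl, rfl, hy.symm⟩
    · exact ⟨.inl x, .inl y, ⟨h, hx, hy⟩, rfl, rfl⟩

lemma connected_expandCycle (hC : C.Connected) : r.expandCycle.Connected := by
  have hinr (i) : r.expandCycle.Reachable (.inr i) (.inl r.center) := Adj.reachable (.inl rfl)
  have hside (i) : r.expandCycle.Reachable (.inl r.center) (.inl (r.side i)) :=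
    (hinr i).symm.trans (Adj.reachable (.inr rfl))
  have hadj (x y) (h : C.Adj x y) : r.expandCycle.Reachable (.inl x) (.inl y) := by
    by_cases hx : x = r.center
    · obtain ⟨i, rfl⟩ := r.adj_center_iff.1 (hx ▸ h)
      exact hx ▸ hside i
    by_cases hy : y = r.center
    · obtain ⟨i, rfl⟩ := r.adj_center_iff.1 (hy ▸ h.symm)
      exact hy ▸ (hside i).symm
    · exact Adj.reachable ⟨h, hx, hy⟩
  have hcenter (p) : r.expandCycle.Reachable p (.inl r.center) := by
    rcases p with x | i
    · exact reachable_of_forall_adj_reachable hadj (hC x r.center)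
    · exact hinr i
  have : Nonempty (V ⊕ Bool) := ⟨.inl r.center⟩
  exact ⟨fun p q ↦ (hcenter p).trans (hcenter q).symm⟩

lemma expandCycle_le_support (hC : C ≤ w.support) : r.expandCycle ≤ (r.expand k).support := by
  rintro (x | i) (y | j) h
  · exact expand_support_adj_inl_inl.2 ⟨hC h.1, by simp [h.2]⟩
  · exact expand_support_adj_inl_inr.2 h
  · exact (expand_support_adj_inl_inr.2 h).symm
  · exact h.elim

lemma isSpanningCycle_expandCycle (hC : IsSpanningCycle C) (hle : C ≤ w.support) :
    IsSpanningCycle r.expandCycle where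
  connected := connected_expandCycle hC.connected
  ncard_neighborSet := by
    rintro (x | i)
    · by_cases hx : x = r.center
      · have hcenter : r.expandCycle.neighborSet (.inl x) = {.inr false, .inr true} := by
          ext (y | j)
          · simp [expandCycle_adj_inl_inl, hx]
          · cases j <;> simp [expandCycle_adj_inl_inr, hx]
        rw [hcenter, Set.ncard_pair (by simp)]
      · rw [← ncard_neighborSet_map_contract (expandCycle_le_support (k := 0) hle) hx,
          map_contract_expandCycle, hC.ncard_neighborSet]
    · have hinr : r.expandCycle.neighborSet (.inr i) = {.inl r.center, .inl (r.side i)} := by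
        ext (y | j)
        · simp [r.expandCycle.adj_comm (.inr i), expandCycle_adj_inl_inr]
        · simp [expandCycle]
      rw [hinr, Set.ncard_pair (by simp [(r.side_ne_center i).symm])]

/-- The contraction of a spanning cycle avoids the edge to the third neighbor, so the cycle uses
the outer edges at `inr false` and `inr true` and both triangle edges at `inl center`. -/
lemma le_expandCycle_of_map_contract_eq (hD : D ≤ (r.expand k).support)
    (hcycle : IsSpanningCycle D) (hmap : D.map r.contract = C) : D ≤ r.expandCycle := by
  have hthird : ¬ D.Adj (.inl r.center) (.inl r.third) := by
    rw [← adj_map_contract_center_third_iff hD, hmap, r.adj_center_iff, not_exists]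
    exact r.third_ne_side
  have hcenter := (ncard_eq_two_iff_of_subset (by simp) (by simp) (by simp)
    (neighborSet_inl_center_subset hD)).1 (hcycle.ncard_neighborSet _)
  have hinr (i : Bool) : ¬ D.Adj (.inr i) (.inr !i) := fun h ↦ by
    have hi := (ncard_eq_two_iff_of_subset (by simp) (by simp [(r.side_ne_center i).symm])
      (by simp) (neighborSet_inr_subset hD i)).1 (hcycle.ncard_neighborSet _)
    have hside : D.Adj (.inr i) (.inl (r.side i)) := by
      rw [← adj_map_contract_center_side_iff hD, hmap]
      exact r.adj_side i
    have hadj : D.Adj (.inr i) (.inl r.center) := by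
      cases i <;> simp_all [D.adj_comm (.inr _) (.inl r.center)]
    simp_all
  have hcenter' (y) : ¬ D.Adj (.inl r.center) (.inl y) := fun h ↦ by
    have := neighborSet_inl_center_subset hD h
    simp_all
  rintro (x | i) (y | j) h
  · have hx : x ≠ r.center := fun hx ↦ hcenter' y (hx ▸ h)
    have hy : y ≠ r.center := fun hy ↦ hcenter' x (hy ▸ h.symm)
    refine ⟨hmap ▸ ⟨fun hxy ↦ h.ne (congrArg _ hxy), _, _, h, rfl, rfl⟩, hx, hy⟩
  · exact expand_support_adj_inl_inr.1 (hD h)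
  · exact expand_support_adj_inl_inr.1 (hD h).symm
  · obtain rfl := Bool.eq_not.2 (expand_support_adj_inr_inr.1 (hD h)).1.symm
    exact (hinr i h).elim

theorem isUniqueSpanningCycle_expand (hC : w.IsUniqueSpanningCycle C) :
    (r.expand k).IsUniqueSpanningCycle r.expandCycle where
  isSpanningCycle := isSpanningCycle_expandCycle hC.isSpanningCycle hC.le_support
  apply_eq_one := apply_expandCycle_eq_one hC.apply_eq_one
  eq_of_le hD hcycle := by
    have hmap := hC.eq_of_le (map_contract_le_support hC.le_support hD)
      (isSpanningCycle_map_contract hD hcycle)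
    exact hcycle.eq_of_le (isSpanningCycle_expandCycle hC.isSpanningCycle hC.le_support)
      (le_expandCycle_of_map_contract_eq hD hcycle hmap)

end SpanningCycle

open Classical in
lemma apply_eq_expand_inl_add_ite (hC : w.IsUniqueSpanningCycle C) (x y : V) :
    w x y = r.expand k (.inl x) (.inl y) +
      if (x = r.center ∨ y = r.center) ∧ C.Adj x y then 1 else 0 := by
  simp only [expand]
  split_ifs with h
  · rw [hC.apply_eq_one h.2]
  · rfl

lemma degree_expand_inl [Fintype V] (hC : w.IsUniqueSpanningCycle C) (x : V) :
    (r.expand k).degree (.inl x) = w.degree x := by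
  classical
  let P (i : Bool) (y : V) : Prop := x = r.center ∧ y = r.side i ∨ x = r.side i ∧ y = r.center
  have hremoved (y : V) : (if (x = r.center ∨ y = r.center) ∧ C.Adj x y then 1 else 0) =
      ∑ i, if P i y then 1 else 0 := by
    have hP : (x = r.center ∨ y = r.center) ∧ C.Adj x y ↔ ∃ i, P i y := by
      have hx := r.adj_center_iff (x := y)
      have hy := r.adj_center_iff (x := x)
      grind [C.adj_comm x y]
    have hdisj : ¬ (P true y ∧ P false y) := by
      have := r.side_injective.ne (a₁ := true) (a₂ := false) (by simp)
      grind [r.side_ne_center]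
    simp only [Fintype.sum_bool, hP, Bool.exists_bool]
    grind
  have hcorner (i : Bool) : r.expand k (.inl x) (.inr i) = ∑ y, if P i y then 1 else 0 := by
    by_cases hx : x = r.center
    · simp [P, expand, hx, (r.side_ne_center i).symm]
    · simp [P, expand, hx, ite_and]
  simp only [EdgeMultiplicity.degree, Fintype.sum_sum_type, hcorner,
    apply_eq_expand_inl_add_ite (r := r) (k := k) hC, Finset.sum_add_distrib, hremoved]
  rw [Finset.sum_comm]

lemma degree_expand_inr [Fintype V] (i : Bool) : (r.expand k).degree (.inr i) = k + 2 := by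
  classical
  have hpair : ({x | x = r.center ∨ x = r.side i} : Finset V) = {r.center, r.side i} := by
    ext x
    simp
  have hcard := Finset.card_pair (r.side_ne_center i).symm
  cases i <;>
    simp [EdgeMultiplicity.degree, expand, Finset.sum_boole, hpair, hcard, add_comm]

/-- The triangle vertex `inl center` is again cubic, so the expansion can be repeated. -/
def expandVertex (r : CubicVertex w C) (k : ℕ) : CubicVertex (r.expand k) r.expandCycle where
  center := .inl r.center
  side := .inr
  third := .inl r.third
  side_injective := Sum.inr_injective
  third_ne_side i := by simp
  adj_center_iff := by
    rintro (x | i)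
    · simp [expandCycle_adj_inl_inl]
    · simp [expandCycle_adj_inl_inr]
  eq_of_apply_ne_zero {p} h := by
    have := neighborSet_inl_center_subset le_rfl (show (r.expand k).support.Adj _ p from h)
    grind

section Connectivity

lemma apply_third_ne_zero (hw : IsVertexConnected w.support 3) (r : CubicVertex w C) :
    w r.center r.third ≠ 0 := fun hthird ↦ by
  classical
  have : Fintype V := @Fintype.ofFinite V (Nat.finite_of_card_ne_zero hw.lt_card.ne_bot)
  let X : Finset V := {r.side false, r.side true}
  have hX : X.card < 3 := Finset.card_le_two.trans_lt (by simp)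
  obtain ⟨y, hy⟩ : ∃ y, y ∉ insert r.center X := by
    refine Finset.exists_mem_notMem_of_card_lt_card (t := Finset.univ) ?_ |>.imp fun _ h ↦ h.2
    rw [Finset.card_univ, ← Nat.card_eq_fintype_card]
    exact (Finset.card_insert_le _ _).trans_lt (by have := hw.lt_card; omega)
  rw [Finset.mem_insert, not_or] at hy
  have hcenter : r.center ∉ X := by simp [X, (r.side_ne_center _).symm]
  obtain ⟨p⟩ := hw.reachable X hX _ hcenter y hy.2
  cases p with
  | nil => exact hy.1 rfl
  | @cons _ z _ h _ =>
    obtain rfl | ⟨i, rfl⟩ := r.eq_of_apply_ne_zero h.1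
    · exact h.1 hthird
    · exact h.2.2 (by cases i <;> simp [X])

/-- The vertices of the triangle. -/
def corner (r : CubicVertex w C) : Option Bool → V ⊕ Bool
  | none => .inl r.center
  | some i => .inr i

/-- The neighbor of a corner of the triangle outside of the triangle. -/
def outer (r : CubicVertex w C) : Option Bool → V
  | none => r.third
  | some i => r.side i

lemma corner_injective (r : CubicVertex w C) : Injective r.corner := by
  rintro (_ | i) (_ | j) h <;> simp_all [corner]

lemma outer_injective (r : CubicVertex w C) : Injective r.outer := by
  rintro (_ | i) (_ | j) h
  · rfl
  · exact absurd h (r.third_ne_side j)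
  · exact absurd h.symm (r.third_ne_side i)
  · exact congrArg _ (r.side_injective h)

lemma exists_corner_eq {p : V ⊕ Bool} (h : r.contract p = r.center) : ∃ o, r.corner o = p := by
  rcases p with x | i
  · exact ⟨none, congrArg _ h.symm⟩
  · exact ⟨some i, rfl⟩

lemma expand_support_adj_corner (hk : k ≠ 0) {o o' : Option Bool} (h : o ≠ o') :
    (r.expand k).support.Adj (r.corner o) (r.corner o') := by
  rcases o with _ | i <;> rcases o' with _ | j
  · exact absurd rfl h
  · exact expand_support_adj_inl_inr.2 (.inl rfl)
  · exact (expand_support_adj_inl_inr.2 (.inl rfl)).symm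
  · exact expand_support_adj_inr_inr.2 ⟨by simpa using h, hk⟩

lemma expand_support_adj_corner_outer (hthird : w r.center r.third ≠ 0) (o : Option Bool) :
    (r.expand k).support.Adj (r.corner o) (.inl (r.outer o)) := by
  rcases o with _ | i
  · refine expand_support_adj_inl_inl.2 ⟨hthird, fun h ↦ ?_⟩
    obtain ⟨i, hi⟩ := r.adj_center_iff.1 h.2
    exact r.third_ne_side i hi
  · exact (expand_support_adj_inl_inr.2 (.inr rfl)).symm

lemma outer_ne_center (hthird : w r.center r.third ≠ 0) (o : Option Bool) :
    r.outer o ≠ r.center := by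
  rcases o with _ | i
  · exact fun h ↦ hthird ((congrArg _ h).trans (w.self _))
  · exact r.side_ne_center i

lemma contract_corner (r : CubicVertex w C) (o : Option Bool) :
    r.contract (r.corner o) = r.center := by
  rcases o with _ | i <;> rfl

lemma corner_ne_inl_outer (hthird : w r.center r.third ≠ 0) (o o' : Option Bool) :
    r.corner o ≠ .inl (r.outer o') := fun h ↦
  outer_ne_center hthird o' ((congrArg r.contract h).symm.trans (r.contract_corner o))

variable {X : Set (V ⊕ Bool)}

lemma notMem_of_contract_notMem_image {p : V ⊕ Bool} (h : r.contract p ∉ r.contract '' X) :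
    p ∉ X := fun hp ↦ h (Set.mem_image_of_mem _ hp)

lemma reachable_inl_side {i : Bool} (h : r.center ∉ r.contract '' X)
    (hi : r.side i ∉ r.contract '' X) : (isolate (r.expand k).support X).Reachable
      (.inl r.center) (.inl (r.side i)) := by
  have hinr : .inr i ∉ X := notMem_of_contract_notMem_image (r := r) h
  exact Reachable.trans
    (Adj.reachable ⟨expand_support_adj_inl_inr.2 (.inl rfl), notMem_of_contract_notMem_image h,
      hinr⟩)
    (Adj.reachable ⟨(expand_support_adj_inl_inr.2 (.inr rfl)).symm, hinr,
      notMem_of_contract_notMem_image hi⟩)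

lemma reachable_inl_of_adj {x y : V} (h : (isolate w.support (r.contract '' X)).Adj x y) :
    (isolate (r.expand k).support X).Reachable (.inl x) (.inl y) := by
  obtain ⟨hadj, hx, hy⟩ := h
  by_cases hC : (x = r.center ∨ y = r.center) ∧ C.Adj x y
  · obtain ⟨rfl | rfl, hC⟩ := hC
    · obtain ⟨i, rfl⟩ := r.adj_center_iff.1 hC
      exact reachable_inl_side hx hy
    · obtain ⟨i, rfl⟩ := r.adj_center_iff.1 hC.symm
      exact (reachable_inl_side hy hx).symm
  · exact Adj.reachable ⟨expand_support_adj_inl_inl.2 ⟨hadj, hC⟩,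
      notMem_of_contract_notMem_image hx, notMem_of_contract_notMem_image hy⟩

/-- If the outer neighbor of a corner is deleted, then a remaining corner still has its own. -/
lemma exists_reachable_inl_of_corner (hk : k ≠ 0) (hthird : w r.center r.third ≠ 0)
    {X : Finset (V ⊕ Bool)} (hX : X.card < 3) {o o₁ : Option Bool} (ho : r.corner o ∉ X)
    (ho₁ : r.corner o₁ ∈ X) : ∃ o₂, .inl (r.outer o₂) ∉ X ∧
      (isolate (r.expand k).support X).Reachable (r.corner o) (.inl (r.outer o₂)) := by
  classical
  by_cases houter : .inl (r.outer o) ∈ X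
  · have hX' : {r.corner o₁, .inl (r.outer o)} = X := by
      refine Finset.eq_of_subset_of_card_le (by grind) ?_
      rw [Finset.card_pair (corner_ne_inl_outer hthird _ _)]
      exact Nat.le_of_lt_succ hX
    have hthree : ∀ a b : Option Bool, ∃ c, c ≠ a ∧ c ≠ b := by decide
    obtain ⟨o₂, hne, hne₁⟩ := hthree o o₁
    have hcorner : r.corner o₂ ∉ X := by
      simp [← hX', r.corner_injective.ne hne₁, corner_ne_inl_outer hthird]
    have houter₂ : .inl (r.outer o₂) ∉ X := by
      simp [← hX', r.outer_injective.ne hne, (corner_ne_inl_outer hthird _ _).symm]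
    exact ⟨o₂, houter₂, Reachable.trans
      (Adj.reachable ⟨expand_support_adj_corner hk hne.symm, ho, hcorner⟩)
      (Adj.reachable ⟨expand_support_adj_corner_outer hthird o₂, hcorner, houter₂⟩)⟩
  · exact ⟨o, houter, Adj.reachable ⟨expand_support_adj_corner_outer hthird o, ho, houter⟩⟩

lemma exists_reachable_inl (hk : k ≠ 0) (hthird : w r.center r.third ≠ 0)
    {X : Finset (V ⊕ Bool)} (hX : X.card < 3) {p : V ⊕ Bool} (hp : p ∉ X) :
    ∃ x ∉ r.contract '' X, (isolate (r.expand k).support X).Reachable p (.inl x) := by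
  by_cases h : r.contract p ∈ r.contract '' X
  · obtain ⟨q, hq, hqp⟩ := h
    have hcenter : r.contract p = r.center := by
      by_contra hne
      rw [eq_inl_of_contract_ne_center hne, ← hqp,
        ← eq_inl_of_contract_ne_center (hqp ▸ hne)] at hp
      exact hp hq
    obtain ⟨o, rfl⟩ := exists_corner_eq hcenter
    obtain ⟨o₁, rfl⟩ := exists_corner_eq (hqp.trans hcenter)
    obtain ⟨o₂, ho₂, hreach⟩ := exists_reachable_inl_of_corner hk hthird hX hp hq
    refine ⟨_, ?_, hreach⟩
    rintro ⟨p', hp', heq⟩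
    rw [← heq, ← eq_inl_of_contract_ne_center (heq ▸ outer_ne_center hthird o₂)] at ho₂
    exact ho₂ hp'
  · rcases p with x | i
    · exact ⟨x, h, .rfl⟩
    · exact ⟨r.center, h, Adj.reachable
        ⟨(expand_support_adj_inl_inr.2 (.inl rfl)).symm, hp, notMem_of_contract_notMem_image h⟩⟩

theorem isVertexConnected_expand (hw : IsVertexConnected w.support 3) (hk : k ≠ 0) :
    IsVertexConnected (r.expand k).support 3 where
  lt_card := by
    have : Finite V := Nat.finite_of_card_ne_zero hw.lt_card.ne_bot
    rw [Nat.card_sum]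
    exact hw.lt_card.trans_le (Nat.le_add_right _ _)
  reachable X hX p hp q hq := by
    classical
    have hthird := apply_third_ne_zero hw r
    obtain ⟨x, hx, hpx⟩ := exists_reachable_inl hk hthird hX hp
    obtain ⟨y, hy, hqy⟩ := exists_reachable_inl hk hthird hX hq
    have hxy := hw.reachable (X.image r.contract) (Finset.card_image_le.trans_lt hX) x
      (by simpa using hx) y (by simpa using hy)
    rw [Finset.coe_image] at hxy
    exact (hpx.trans (reachable_of_forall_adj_reachable (fun _ _ ↦ reachable_inl_of_adj) hxy)).trans
      hqy.symm

end Connectivity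

end CubicVertex

end Expansion

section BaseGraph

open SimpleGraph

section Search

variable {V : Type*} [DecidableEq V]

/-- All ways to select two entries of `nbr x` for each vertex `x` of a list such that two vertices
of the list either select each other or do not select each other. The neighborhoods along a
spanning cycle are such a selection. -/
def neighborChoices (nbr : V → List V) : List V → List (V → List V)
  | [] => [fun _ ↦ []]
  | x :: l => (neighborChoices nbr l).flatMap fun N ↦
      (((nbr x).sublistsLen 2).filter fun S ↦ l.all fun y ↦ decide (y ∈ S ↔ x ∈ N y)).map
        (update N x)

/-- `X` is a nonempty part of `l` that cannot be left along the neighborhoods `N`. -/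
def isTrap (N : V → List V) (l X : List V) : Bool :=
  !X.isEmpty && X.all fun x ↦ x ∈ l && (N x).all (· ∈ X)

/-- A path, with its last vertex first, is prolonged by a new vertex if possible. -/
def prolong (N : V → List V) : List V → List V
  | [] => []
  | x :: X => ((N x).filter (· ∉ x :: X)).take 1 ++ x :: X

variable {D : SimpleGraph V} {nbr N : V → List V} {l X : List V}

lemma IsSpanningCycle.exists_mem_neighborChoices (hD : IsSpanningCycle D)
    (hnodup : ∀ x, (nbr x).Nodup) (hnbr : ∀ x y, D.Adj x y → y ∈ nbr x) (hl : l.Nodup) :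
    ∃ N ∈ neighborChoices nbr l, ∀ x ∈ l, ∀ y, y ∈ N x ↔ D.Adj x y := by
  classical
  induction l with
  | nil => simp [neighborChoices]
  | cons x l ih =>
    obtain ⟨hx, hl⟩ := List.nodup_cons.1 hl
    obtain ⟨N, hN, hadj⟩ := ih hl
    let S := (nbr x).filter (D.Adj x ·)
    have hS (y : V) : y ∈ S ↔ D.Adj x y := by
      simpa only [S, List.mem_filter, decide_eq_true_iff] using
        and_iff_right_of_imp (hnbr x y)
    have hlength : S.length = 2 := by
      have hcoe : (S.toFinset : Set V) = D.neighborSet x := by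
        ext y
        rw [List.coe_toFinset, Set.mem_ofPred_eq, hS, mem_neighborSet]
      rw [← hD.ncard_neighborSet x, ← hcoe, Set.ncard_coe_finset,
        List.toFinset_card_of_nodup ((hnodup x).filter _)]
    refine ⟨update N x S, ?_, fun y hy z ↦ ?_⟩
    · refine List.mem_flatMap.2 ⟨N, hN, List.mem_map.2 ⟨S, List.mem_filter.2 ⟨?_, ?_⟩, rfl⟩⟩
      · exact List.mem_sublistsLen.2 ⟨List.filter_sublist, hlength⟩
      · simpa [hS] using fun y hy ↦ (D.adj_comm x y).trans (hadj y hy x).symm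
    · obtain rfl | hyx := eq_or_ne y x
      · simpa using hS z
      · simpa [hyx] using hadj y (List.mem_of_ne_of_mem hyx hy) z

lemma not_isTrap (hD : D.Connected) (hN : ∀ x ∈ l, ∀ y, y ∈ N x ↔ D.Adj x y) {v : V}
    (hv : v ∉ l) : ¬ isTrap N l X := by
  simp only [isTrap, Bool.and_eq_true, Bool.not_eq_true', List.isEmpty_eq_false_iff_exists_mem,
    List.all_eq_true, decide_eq_true_iff]
  rintro ⟨⟨x, hx⟩, htrap⟩
  obtain ⟨p⟩ := hD.preconnected x v
  obtain ⟨d, -, hfst, hsnd⟩ := p.exists_boundary_dart {y | y ∈ X} hx fun h ↦ hv (htrap v h).1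
  exact hsnd ((htrap _ hfst).2 _ ((hN _ (htrap _ hfst).1 _).2 d.adj))

end Search

/-- The neighbors along the chords of a `28`-cycle. Together with the cycle they form two copies
(the second one shifted by `14`) of a Petersen graph without one vertex, in which a vertex and
its three neighbors are replaced by the triangles `2, 7, 12` and `1, 2, 3`, `6, 7, 8`,
`11, 12, 13`. The copies are joined by the edges `13 14`, `27 0` and `5 19`. -/
def chordNeighbors (x : Fin 28) : List (Fin 28) :=
  [[9], [3], [7, 12], [1], [10], [19], [8], [2, 12], [6], [0], [4], [13], [2, 7], [11], [23], [17],
    [21, 26], [15], [24], [5], [22], [16, 26], [20], [14], [18], [27], [16, 21], [25]].getD x []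

/-- The multiplicities of the chords, such that the chord degree is `2` everywhere. -/
def chordMultiplicity (x y : Fin 28) : ℕ :=
  if y ∈ chordNeighbors x then 2 / (chordNeighbors x).length else 0

/-- The `28`-cycle with `r`-fold chords; all its degrees are `2 * r + 2`. -/
def baseMultiplicity (r : ℕ) : EdgeMultiplicity (Fin 28) where
  toFun x y := (if (cycleGraph 28).Adj x y then 1 else 0) + r * chordMultiplicity x y
  symm' := by
    have h : ∀ x y, chordMultiplicity x y = chordMultiplicity y x := by decide +kernel
    simp [adj_comm, h]
  self' := by
    have h : ∀ x, chordMultiplicity x x = 0 := by decide +kernel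
    simp [h]

/-- The neighbors of a vertex of the base graph. -/
def baseNeighbors (x : Fin 28) : List (Fin 28) := (x + 1) :: (x - 1) :: chordNeighbors x

/-- The vertices of the first of the two copies. -/
def firstHalf : List (Fin 28) := [0, 1, 2, 3, 4, 5, 6, 7, 8, 9, 10, 11, 12, 13]

variable {r : ℕ} {D : SimpleGraph (Fin 28)} {x y : Fin 28}

lemma baseMultiplicity_apply : baseMultiplicity r x y =
    (if (cycleGraph 28).Adj x y then 1 else 0) + r * chordMultiplicity x y := rfl

lemma degree_baseMultiplicity : (baseMultiplicity r).degree x = 2 * r + 2 := by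
  have hrim : ∀ x, (∑ y, if (cycleGraph 28).Adj x y then 1 else 0) = 2 := by decide +kernel
  have hchord : ∀ x, ∑ y, chordMultiplicity x y = 2 := by decide +kernel
  rw [EdgeMultiplicity.degree]
  simp only [baseMultiplicity_apply, Finset.sum_add_distrib, ← Finset.mul_sum, hrim, hchord]
  ring

lemma mem_baseNeighbors (h : (baseMultiplicity r).support.Adj x y) : y ∈ baseNeighbors x := by
  by_contra hy
  simp only [baseNeighbors, List.mem_cons, not_or, ← sub_eq_iff_eq_add'] at hy
  obtain ⟨hsucc, hpred, hchord⟩ := hy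
  refine EdgeMultiplicity.support_adj.1 h ?_
  have : ¬ (cycleGraph 28).Adj x y := by
    rw [cycleGraph_adj_iff_eq_add_one]
    grind
  simp [baseMultiplicity_apply, this, chordMultiplicity, hchord]

/- Three edges leave the first half, and two of them belong to a spanning cycle. The search shows
that the edge `13 14` is always one of them, and that the rim is used if `0 27` is the other one.
The same statement for the second half exchanges the roles of these two edges. -/
lemma adj_of_isSpanningCycle (hD : IsSpanningCycle D)
    (hnbr : ∀ x y, D.Adj x y → y ∈ baseNeighbors x) :
    D.Adj 13 14 ∧ (D.Adj 0 27 → ∀ x ∈ firstHalf, ∀ y, D.Adj x y → (cycleGraph 28).Adj x y) := by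
  have hsearch : ∀ N ∈ neighborChoices baseNeighbors firstHalf,
      (∃ x ∈ firstHalf, isTrap N firstHalf ((prolong N)^[13] [x])) ∨
        14 ∈ N 13 ∧ (27 ∉ N 0 ∨ ∀ x ∈ firstHalf, ∀ y ∈ N x, (cycleGraph 28).Adj x y) := by
    decide +kernel
  obtain ⟨N, hN, hadj⟩ := hD.exists_mem_neighborChoices (by decide) hnbr
    (show firstHalf.Nodup by decide)
  obtain ⟨x, -, htrap⟩ | ⟨hlast, hrim⟩ := hsearch N hN
  · exact absurd htrap (not_isTrap hD.connected hadj (show 14 ∉ firstHalf by decide))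
  · refine ⟨(hadj 13 (by decide) 14).1 hlast, fun h x hx y hxy ↦ ?_⟩
    have hrim := hrim.resolve_left (not_not.2 ((hadj 0 (by decide) 27).2 h))
    exact hrim x hx y ((hadj x hx y).2 hxy)

lemma le_cycleGraph_of_isSpanningCycle (hD : IsSpanningCycle D)
    (hnbr : ∀ x y, D.Adj x y → y ∈ baseNeighbors x) : D ≤ cycleGraph 28 := by
  let φ := Iso.comap (Equiv.addRight (14 : Fin 28)) D
  have hnbr' : ∀ x, ∀ y ∈ baseNeighbors (x + 14), y - 14 ∈ baseNeighbors x := by decide +kernel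
  obtain ⟨h, hrim⟩ := adj_of_isSpanningCycle hD hnbr
  obtain ⟨h', hrim'⟩ := adj_of_isSpanningCycle (hD.of_iso φ.symm) fun x y hxy ↦ by
    simpa [φ] using hnbr' x _ (hnbr _ _ hxy)
  intro x y hxy
  by_cases hx : x ∈ firstHalf
  · exact hrim h'.symm x hx y hxy
  · have hx' : ∀ x ∉ firstHalf, x - 14 ∈ firstHalf := by decide
    have := hrim' h.symm (x - 14) (hx' x hx) (y - 14) (by simpa [φ] using hxy)
    simpa [cycleGraph_adj] using this

lemma isUniqueSpanningCycle_baseMultiplicity :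
    (baseMultiplicity r).IsUniqueSpanningCycle (cycleGraph 28) where
  isSpanningCycle := isSpanningCycle_cycleGraph 25
  apply_eq_one {x y} h := by
    have hchord : ∀ x y, (cycleGraph 28).Adj x y → chordMultiplicity x y = 0 := by decide +kernel
    simp [baseMultiplicity_apply, h, hchord x y h]
  eq_of_le hle hD := hD.eq_of_le (isSpanningCycle_cycleGraph 25)
    (le_cycleGraph_of_isSpanningCycle hD fun _ _ h ↦ mem_baseNeighbors (hle h))

/-- The vertex of the base graph at which vertices are inserted. -/
def baseVertex (r : ℕ) : CubicVertex (baseMultiplicity r) (cycleGraph 28) where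
  center := 0
  side i := if i then 1 else 27
  third := 9
  side_injective := by decide
  third_ne_side := by decide
  adj_center_iff {x} := by revert x; decide
  eq_of_apply_ne_zero {x} h := by
    have hnbr : ∀ x ∈ baseNeighbors 0, x = 9 ∨ ∃ i : Bool, x = if i then 1 else 27 := by decide
    exact hnbr x (mem_baseNeighbors (EdgeMultiplicity.support_adj.2 h))

lemma isVertexConnected_support_baseMultiplicity (hr : r ≠ 0) :
    IsVertexConnected (baseMultiplicity r).support 3 := by
  refine isVertexConnected_three_of_chords (m := 24)
    isUniqueSpanningCycle_baseMultiplicity.le_support fun p q hpq hin hout ↦ ?_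
  have hchord : ∀ p q : Fin 28, p < q → (p = 0 ∧ q = 27) ∨ q = p + 1 ∨
      ∃ i, (p < i ∧ i < q) ∧ ∃ j ∈ chordNeighbors i, j < p ∨ q < j := by decide +kernel
  have hpos : ∀ i, ∀ j ∈ chordNeighbors i, chordMultiplicity i j ≠ 0 := by decide +kernel
  obtain ⟨rfl, rfl⟩ | rfl | ⟨i, hi, j, hij, hj⟩ := hchord p q hpq
  · grind
  · grind
  refine ⟨i, j, hi, hj, EdgeMultiplicity.support_adj.2 ?_⟩
  simp [baseMultiplicity_apply, hr, hpos i j hij]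

end BaseGraph

section Realization

open SimpleGraph

variable {n d : ℕ} {S : Set ℕ} {M : Finset ℕ}

/-- There is a uniquely hamiltonian multigraph on `n` vertices with degree set `S` at which a
further vertex of any degree can be inserted. It is `3`-connected unless `S` contains `2`. -/
def IsRealizable (n : ℕ) (S : Set ℕ) : Prop :=
  ∃ (V : Type) (_ : Fintype V) (w : EdgeMultiplicity V) (C : SimpleGraph V),
    Nonempty (CubicVertex w C) ∧ w.IsUniqueSpanningCycle C ∧
      (2 ∉ S → IsVertexConnected w.support 3) ∧ Fintype.card V = n ∧ Set.range w.degree = S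

lemma isRealizable_singleton (hd : 2 ≤ d) (heven : Even d) : IsRealizable 28 {d} := by
  obtain ⟨r, rfl⟩ : ∃ r, d = 2 * r + 2 := ⟨d / 2 - 1, by grind⟩
  refine ⟨Fin 28, inferInstance, baseMultiplicity r, cycleGraph 28, ⟨baseVertex r⟩,
    isUniqueSpanningCycle_baseMultiplicity, fun h ↦ ?_, Fintype.card_fin 28, ?_⟩
  · exact isVertexConnected_support_baseMultiplicity (by rintro rfl; exact h rfl)
  · simp only [funext fun x ↦ degree_baseMultiplicity (r := r) (x := x), Set.range_const]

namespace IsRealizable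

protected lemma insert (h : IsRealizable n S) (hd : 2 ≤ d) :
    IsRealizable (n + 2) (insert d S) := by
  obtain ⟨k, rfl⟩ := Nat.exists_eq_add_of_le' hd
  obtain ⟨V, _, w, C, ⟨r⟩, hC, hconn, rfl, rfl⟩ := h
  refine ⟨V ⊕ Bool, inferInstance, r.expand k, r.expandCycle, ⟨r.expandVertex k⟩,
    CubicVertex.isUniqueSpanningCycle_expand hC, fun h2 ↦ ?_, by simp, ?_⟩
  · rw [Set.mem_insert_iff, not_or] at h2
    exact CubicVertex.isVertexConnected_expand (hconn h2.2) (by rintro rfl; exact h2.1 rfl)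
  · have hinl : (r.expand k).degree ∘ Sum.inl = w.degree :=
      funext (CubicVertex.degree_expand_inl hC)
    have hinr : (r.expand k).degree ∘ Sum.inr = fun _ ↦ k + 2 :=
      funext CubicVertex.degree_expand_inr
    rw [Sum.range_eq, hinl, hinr, Set.range_const, Set.union_singleton]

lemma union_list (h : IsRealizable n S) {L : List ℕ} (hL : ∀ d ∈ L, 2 ≤ d) :
    IsRealizable (n + 2 * L.length) (S ∪ {d | d ∈ L}) := by
  induction L with
  | nil => simpa using h
  | cons d L ih =>
    convert (ih fun x hx ↦ hL x (List.mem_cons_of_mem d hx)).insert (hL d List.mem_cons_self)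
      using 1
    · rw [List.length_cons, mul_add_one, add_assoc]
    · ext x
      simp only [Set.mem_union, Set.mem_ofPred_eq, List.mem_cons, Set.mem_insert_iff]
      tauto

lemma exists_graph (h : IsRealizable n M) :
    ∃ G : Graph ℕ ℕ, IsUHMultigraphWithDegrees G M ∧ V(G).ncard = n ∧ G.IsKConnected 2 ∧
      (2 ∉ M → G.IsKConnected 3) := by
  obtain ⟨V, _, w, C, -, hC, hconn, hcard, hdeg⟩ := h
  obtain ⟨f, hf⟩ := Countable.exists_injective_nat V
  obtain ⟨g, hg⟩ := Countable.exists_injective_nat (Sym2 V × ℕ)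
  refine ⟨w.toGraph ⟨f, hf⟩ ⟨g, hg⟩, ⟨EdgeMultiplicity.isMultigraph_toGraph,
    EdgeMultiplicity.isUniquelyHamiltonian_toGraph hC,
    EdgeMultiplicity.degreeSet_toGraph.trans hdeg⟩, ?_, ?_, fun h2 ↦ ?_⟩
  · exact (Set.ncard_range_of_injective hf).trans (Nat.card_eq_fintype_card.trans hcard)
  · exact (hC.isSpanningCycle.isVertexConnected_two hC.le_support).isKConnected_toGraph _ _
  · exact (hconn (mod_cast h2)).isKConnected_toGraph _ _

end IsRealizable

lemma isRealizable_of_even_mem (hM : ∀ d ∈ M, 2 ≤ d) (hd : d ∈ M) (heven : Even d) (i : ℕ) :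
    IsRealizable (28 + 2 * (M.card + i)) M := by
  have hL : ∀ x ∈ M.toList ++ List.replicate i d, x ∈ M := by
    simp only [List.mem_append, Finset.mem_toList, List.mem_replicate]
    rintro x (hx | ⟨-, rfl⟩)
    exacts [hx, hd]
  convert (isRealizable_singleton (hM d hd) heven).union_list fun x hx ↦ hM x (hL x hx) using 1
  · simp
  · ext x
    simp only [Set.mem_union, Set.mem_singleton_iff, Set.mem_ofPred_eq, Finset.mem_coe]
    refine ⟨fun hx ↦ .inr (List.mem_append_left _ (Finset.mem_toList.2 hx)), ?_⟩
    rintro (rfl | hx)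
    exacts [hd, hL x hx]

lemma ncard_vertexSet_eq_of_isIsomorphic {α β α' β' : Type*} {G : Graph α β} {H : Graph α' β'}
    (h : G.IsIsomorphic H) : V(G).ncard = V(H).ncard :=
  let ⟨f, _⟩ := h
  Nat.card_congr f

lemma infinitelyManyKConnectedUH_of_ncard {k : ℕ} {G : ℕ → Graph ℕ ℕ}
    (hG : ∀ i, IsUHMultigraphWithDegrees (G i) M) (hk : ∀ i, (G i).IsKConnected k)
    (hcard : Injective fun i ↦ V(G i).ncard) : InfinitelyManyKConnectedUH k M :=
  ⟨G, fun i ↦ ⟨hG i, hk i⟩, fun _ _ hij h ↦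
    hij (hcard (ncard_vertexSet_eq_of_isIsomorphic h))⟩

end Realization

lemma exists_even_mem_of_isUHMultigraphWithDegrees {α β : Type*} {G : Graph α β} {M : Finset ℕ}
    (hG : IsUHMultigraphWithDegrees G M) : ∃ d ∈ M, Even d := by
  obtain ⟨hmulti, huniq, hdeg⟩ := hG
  by_contra! hM
  refine not_isUniquelyHamiltonian_of_odd_degree hmulti (fun y hy ↦ ?_) huniq
  have hy : G.degree y ∈ (M : Set ℕ) := hdeg ▸ ⟨y, hy, rfl⟩
  exact Nat.not_even_iff_odd.1 (hM _ hy)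

theorem corollary3p11 (M : Finset ℕ) (hM : ∀ d ∈ M, 2 ≤ d) :
    ((∃ (α β : Type) (G : Graph α β), IsUHMultigraphWithDegrees G M) ↔ ∃ d ∈ M, Even d) ∧
    ((∃ d ∈ M, Even d) →
      (2 ∉ M → InfinitelyManyKConnectedUH 3 M) ∧
      (2 ∈ M → InfinitelyManyKConnectedUH 2 M)) := by
  have hgraphs : (∃ d ∈ M, Even d) → ∀ i, ∃ G : Graph ℕ ℕ, IsUHMultigraphWithDegrees G M ∧
      V(G).ncard = 28 + 2 * (M.card + i) ∧ G.IsKConnected 2 ∧ (2 ∉ M → G.IsKConnected 3) :=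
    fun ⟨_, hd, heven⟩ i ↦ (isRealizable_of_even_mem hM hd heven i).exists_graph
  refine ⟨⟨fun ⟨_, _, _, hG⟩ ↦ exists_even_mem_of_isUHMultigraphWithDegrees hG, fun heven ↦ ?_⟩,
    fun heven ↦ ?_⟩
  · obtain ⟨G, hG, -⟩ := hgraphs heven 0
    exact ⟨ℕ, ℕ, G, hG⟩
  · choose G hG hcard h2 h3 using hgraphs heven
    have hinj : Injective fun i ↦ V(G i).ncard := fun i j h ↦ by
      simp only [hcard] at h
      omega
    exact ⟨fun hM2 ↦ infinitelyManyKConnectedUH_of_ncard hG (fun i ↦ h3 i hM2) hinj,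
      fun _ ↦ infinitelyManyKConnectedUH_of_ncard hG h2 hinj⟩
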